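/- Let $\mathbb D$ be the open unit disc, $\mathbb T=\partial\mathbb D$, $\partial_z=\frac12(\partial_x-i\partial_y)$ and $\partial_{\bar z}=\frac12(\partial_x+i\partial_y)$. For $\alpha>-1$ and $f\in L^1(\mathbb T)$ put, for $z\in\mathbb D$, $$P_{\alpha/2,\alpha/2}[f](z)=\frac{1}{2\pi}\int_0^{2\pi}P_{\alpha/2,\alpha/2}(ze^{-i\theta})f(e^{i\theta})\,d\theta,\qquad P_{\alpha/2,\alpha/2}(z)=\frac{\Gamma(\frac\alpha2+1)^2}{\Gamma(\alpha+1)}\,\frac{(1-|z|^2)^{\alpha+1}}{(1-z)^{\frac\alpha2+1}(1-\bar z)^{\frac\alpha2+1}},$$ and $M_\alpha=P_{\alpha/2,\alpha/2}[1]$. A twice continuously differentiable function $u$ on $\mathbb D$ is called $T_\alpha$-harmonic if $T_\alpha u=0$ in $\mathbb D$, where, with $\omega_\alpha(z)=(1-|z|^2)^\alpha$, $$T_\alpha=-\frac{\alpha^2}{4}\,\omega_{\alpha+1}^{-1}+\frac12\left(\partial_z\,\omega_\alpha^{-1}\,\partial_{\bar z}+\partial_{\bar z}\,\omega_\alpha^{-1}\,\partial_z\right).$$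 For $1\le p\le\infty$ the generalized Hardy space $H_G^p(\mathbb D)$ consists of the measurable $v:\mathbb D\to\mathbb C$, measurable on every circle $|z|=r$, $0<r<1$, with $$\sup_{0<r<1}\left(\frac1{2\pi}\int_0^{2\pi}|v(re^{i\theta})|^p\,d\theta\right)^{1/p}<\infty\ \ (p<\infty),\qquad \sup_{z\in\mathbb D}|v(z)|<\infty\ \ (p=\infty).$$ $L^p(\mathbb D)$ is taken with respect to area measure. **Corollary.** Let $\alpha>-1$ and $1\le p\le\infty$, let $f:\mathbb T\to\mathbb C$ be absolutely continuous with $\dot f\in L^p(\mathbb T)$, where $\dot f(e^{i\theta})=\frac{d}{d\theta}f(e^{i\theta})$, and let $u=P_{\alpha/2,\alpha/2}[f]$. Then $u$ is $T_\alpha$-harmonic, and: 1. If $\alpha>0$, then $\partial_zu$ and $\partial_{\bar z}u$ are in $H_G^p(\mathbb D)$. 2. If $\alpha<0$, then $\partial_zu\in H_G^1(\mathbb D)$ if and only if $u\equiv0$ on $\mathbb D$, and likewise $\partial_{\bar z}u\in H_G^1(\mathbb D)$ if and only if $u\equiv 0$ on $\mathbb D$. 3. If $\alpha<0$ and $p<-\frac1\alpha$,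 then $\partial_zu$ and $\partial_{\bar z}u$ are in $L^p(\mathbb D)$. 4. If $\alpha<0$ and $p\ge-\frac1\alpha$ (including $p=\infty$), then neither $\partial_zM_\alpha$ nor $\partial_{\bar z}M_\alpha$ is in $L^p(\mathbb D)$. -/

import Mathlib

open MeasureTheory Set
open scoped ENNReal ComplexConjugate

noncomputable section

namespace DiscHarmonic

/-- The open unit disc. Functions on the disc are represented by functions on `ℂ`, of which only
the values on the disc matter below (the disc being open, this includes derivatives there). -/
def disc : Set ℂ := Metric.ball 0 1

/-- `∂_z = (∂_x - i ∂_y) / 2`. -/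
def dz (u : ℂ → ℂ) (z : ℂ) : ℂ :=
  (1 / 2) * (fderiv ℝ u z 1 - Complex.I * fderiv ℝ u z Complex.I)

/-- `∂_{z̄} = (∂_x + i ∂_y) / 2`. -/
def dzbar (u : ℂ → ℂ) (z : ℂ) : ℂ :=
  (1 / 2) * (fderiv ℝ u z 1 + Complex.I * fderiv ℝ u z Complex.I)

/-- The constant `c_{α,β} = Γ(α+1) Γ(β+1) / Γ(α+β+1)`. -/
def poissonConst (α β : ℝ) : ℝ :=
  Real.Gamma (α + 1) * Real.Gamma (β + 1) / Real.Gamma (α + β + 1)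

/-- The `(α,β)`-harmonic Poisson kernel
`c_{α,β} (1-|z|²)^{α+β+1} / ((1-z)^{α+1} (1-z̄)^{β+1})`, with principal powers. -/
def poissonKernel (α β : ℝ) (z : ℂ) : ℂ :=
  (poissonConst α β : ℂ) * (((1 - ‖z‖ ^ 2) ^ (α + β + 1) : ℝ) : ℂ) /
    ((1 - z) ^ ((α + 1 : ℝ) : ℂ) * (1 - conj z) ^ ((β + 1 : ℝ) : ℂ))

/-- The `(α,β)`-harmonic Poisson integral
`P_{α,β}[f](z) = (2π)⁻¹ ∫_0^{2π} P_{α,β}(z e^{-iθ}) f(e^{iθ}) dθ`. -/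
def poissonIntegral (α β : ℝ) (f : Circle → ℂ) (z : ℂ) : ℂ :=
  (1 / (2 * Real.pi) : ℂ) *
    ∫ θ in (0 : ℝ)..(2 * Real.pi),
      poissonKernel α β (z * Complex.exp (-(θ * Complex.I))) * f (Circle.exp θ)

/-- `M_α = P_{α/2,α/2}[1]`. -/
def radialM (α : ℝ) : ℂ → ℂ :=
  poissonIntegral (α / 2) (α / 2) (fun _ => 1)

/-- The standard weight `ω_α(z) = (1-|z|²)^α`. -/
def weight (α : ℝ) (z : ℂ) : ℂ := (((1 - ‖z‖ ^ 2) ^ α : ℝ) : ℂ)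

/-- `L_α = ∂_z ω_α⁻¹ ∂_{z̄}`. -/
def opL (α : ℝ) (u : ℂ → ℂ) : ℂ → ℂ := dz (fun w => (weight α w)⁻¹ * dzbar u w)

/-- `L_α^* = ∂_{z̄} ω_α⁻¹ ∂_z`. -/
def opLstar (α : ℝ) (u : ℂ → ℂ) : ℂ → ℂ := dzbar (fun w => (weight α w)⁻¹ * dz u w)

/-- `T_α = -(α²/4) ω_{α+1}⁻¹ + (L_α + L_α^*) / 2`. -/
def opT (α : ℝ) (u : ℂ → ℂ) (z : ℂ) : ℂ :=
  -((α : ℂ) ^ 2 / 4) * (weight (α + 1) z)⁻¹ * u z + (1 / 2) * (opL α u z + opLstar α u z)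

/-- `u` is `T_α`-harmonic: `u` is twice continuously differentiable and `T_α u = 0` in the disc. -/
def IsTHarmonic (α : ℝ) (u : ℂ → ℂ) : Prop :=
  ContDiffOn ℝ 2 u disc ∧ ∀ z ∈ disc, opT α u z = 0

/-- Normalized Lebesgue measure `dθ / 2π` on `(0, 2π]`. -/
def arcMeasure : Measure ℝ :=
  ENNReal.ofReal (2 * Real.pi)⁻¹ • volume.restrict (Ioc 0 (2 * Real.pi))

/-- The restriction `θ ↦ u(r e^{iθ})` of `u` to the circle of radius `r`. -/
def slice (u : ℂ → ℂ) (r : ℝ) (θ : ℝ) : ℂ := u (r * Complex.exp (θ * Complex.I))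

/-- The norm of the generalized Hardy space: the supremum over `0 < r < 1` of the `p`-th means
`M_p(r,u)` if `p < ∞`, and the supremum of `|u|` over the disc if `p = ∞`. -/
def hardyNorm (p : ℝ≥0∞) (u : ℂ → ℂ) : ℝ≥0∞ :=
  if p = ∞ then ⨆ z ∈ disc, ‖u z‖ₑ
  else ⨆ r ∈ Ioo (0 : ℝ) 1, eLpNorm (slice u r) p arcMeasure

/-- Membership in the generalized Hardy space `H_G^p` of the disc. -/
def MemHardyG (p : ℝ≥0∞) (u : ℂ → ℂ) : Prop :=
  AEMeasurable u (volume.restrict disc) ∧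
    (∀ r ∈ Ioo (0 : ℝ) 1, AEMeasurable (slice u r) arcMeasure) ∧
    hardyNorm p u < ∞

/-- Membership in `L^p` of the disc (with respect to area measure). -/
def MemLpDisc (p : ℝ≥0∞) (u : ℂ → ℂ) : Prop := MemLp u p (volume.restrict disc)

/-- `f` is absolutely continuous on the unit circle. -/
def AbsContCircle (f : Circle → ℂ) : Prop :=
  AbsolutelyContinuousOnInterval (fun θ : ℝ => f (Circle.exp θ)) 0 (2 * Real.pi)

/-- The derivative `ḟ(e^{iθ}) = d/dθ f(e^{iθ})`, as a function of `θ`. -/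
def circleDeriv (f : Circle → ℂ) : ℝ → ℂ := deriv (fun θ : ℝ => f (Circle.exp θ))

end DiscHarmonic

end

/-! Harmonicity is checked on the kernel. It is annihilated by $T_\alpha$ (`opT_poissonKernel`),
$T_\alpha$ commutes with rotations, and a Poisson integral is an average of rotated kernels that may
be differentiated under the integral sign (`opT_rotAvg`).

The lower bounds (the vanishing criterion and the failure of $L^p$ membership) come from a radial
ODE. Let $U$ be the $n$-th Fourier mode of a $T_\alpha$-harmonic $u$ on $|z|=r$, and let
$h=r(1-r^2)^{-\alpha}U'$ be its flux. Then $h'=qU$ with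
$q=\alpha^2r(1-r^2)^{-\alpha-1}+n^2(1-r^2)^{-\alpha}/r>0$ when $\alpha\ne0$, so $\mathrm{Re}(h\bar
U)$ increases from $0$. If $U$ is bounded and not identically zero, $|h|$ stays away from $0$ near
$r=1$, that is, $|U'|\ge\kappa(1-r^2)^\alpha$ (`exists_lower_bound_of_ode`). Now $U'$ is the sum of
a mode of $\partial_zu$ and a mode of $\partial_{\bar z}u$, while $r$ times their difference is
$nU$, which is bounded. For $\alpha<0$ both modes therefore blow up, which $H^1_G$ forbids. Hence
all modes of $u$ vanish, and so does $u$. Applied to the radial function $M_\alpha$, the same bound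
gives $|\partial_zM_\alpha|=|\partial_{\bar z}M_\alpha|\ge\kappa'(1-r^2)^\alpha$ near the circle,
and the $(-1/\alpha)$-th power of the right side is not integrable.

The upper bounds rest on subtracting $M_\alpha$. At $re^{it}$ the derivative $\partial u$ equals
$f(e^{it})\,\partial M_\alpha$ plus an integral of the differentiated kernel against
$f(e^{i(t+s)})-f(e^{it})$. The increment has $L^p$ norm in $t$ at most $|s|\,\|\dot f\|_p$, so
Minkowski's inequality bounds the second term by the first absolute moment of the differentiated
kernel (`eLpNorm_rotAvg_sub_le`). That kernel is $O((1-r)^\alpha(1-r+|s|)^{-\alpha-2})$, so the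
moment is $O((1-r)^{\min(\alpha,0)})$. Integrating the flux equation for $n=0$ gives the same order
for $\partial M_\alpha$ (`norm_flux_zero_le`). Thus the $p$-th means of $\partial u$ are bounded if
$\alpha>0$ and $O((1-r)^\alpha)$ if $\alpha<0$. The latter is $p$-integrable over the disc when
$\alpha p>-1$. -/

noncomputable section

namespace DiscHarmonic

open Complex Filter Topology

/-! ### Wirtinger calculus -/

/-- The real-linear map `v ↦ p v + q v̄`. -/
def wirt (p q : ℂ) : ℂ →L[ℝ] ℂ :=
  p • ContinuousLinearMap.id ℝ ℂ + q • (conjCLE : ℂ →L[ℝ] ℂ)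

@[simp] lemma wirt_apply (p q v : ℂ) : wirt p q v = p * v + q * conj v := by
  simp [wirt]

/-- `f` is real differentiable at `z` with Wirtinger derivatives `p` and `q`. -/
def HasWirt (f : ℂ → ℂ) (p q z : ℂ) : Prop := HasFDerivAt f (wirt p q) z

namespace HasWirt

variable {f g : ℂ → ℂ} {p q p' q' z : ℂ}

lemma dz_eq (h : HasWirt f p q z) : dz f z = p := by
  rw [dz, HasFDerivAt.fderiv h]
  simp only [wirt_apply, map_one, conj_I]
  linear_combination (-p / 2 + q / 2) * I_sq

lemma dzbar_eq (h : HasWirt f p q z) : dzbar f z = q := by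
  rw [dzbar, HasFDerivAt.fderiv h]
  simp only [wirt_apply, map_one, conj_I]
  linear_combination (p / 2 - q / 2) * I_sq

lemma const (c z : ℂ) : HasWirt (fun _ => c) 0 0 z := by
  have : wirt 0 0 = 0 := by ext; simp
  rw [HasWirt, this]
  exact hasFDerivAt_const c z

lemma id (z : ℂ) : HasWirt (fun w => w) 1 0 z := by
  have : wirt 1 0 = ContinuousLinearMap.id ℝ ℂ := by ext; simp
  rw [HasWirt, this]
  exact hasFDerivAt_id z

lemma conjugate (z : ℂ) : HasWirt (fun w => conj w) 0 1 z := by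
  have : wirt 0 1 = (conjCLE : ℂ →L[ℝ] ℂ) := by ext; simp
  rw [HasWirt, this]
  exact (conjCLE : ℂ →L[ℝ] ℂ).hasFDerivAt

lemma add (hf : HasWirt f p q z) (hg : HasWirt g p' q' z) :
    HasWirt (fun w => f w + g w) (p + p') (q + q') z := by
  have : wirt (p + p') (q + q') = wirt p q + wirt p' q' := by ext; simp; ring
  rw [HasWirt, this]
  exact HasFDerivAt.add hf hg

lemma mul (hf : HasWirt f p q z) (hg : HasWirt g p' q' z) :
    HasWirt (fun w => f w * g w) (p * g z + f z * p') (q * g z + f z * q') z := by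
  have : wirt (p * g z + f z * p') (q * g z + f z * q') = f z • wirt p' q' + g z • wirt p q := by
    ext; simp; ring
  rw [HasWirt, this]
  exact HasFDerivAt.mul hf hg

lemma const_mul (c : ℂ) (hf : HasWirt f p q z) : HasWirt (fun w => c * f w) (c * p) (c * q) z := by
  simpa using (const c z).mul hf

lemma comp_holo {G : ℂ → ℂ} {G' : ℂ} (hG : HasDerivAt G G' (f z)) (hf : HasWirt f p q z) :
    HasWirt (fun w => G (f w)) (G' * p) (G' * q) z := by
  have h := (hG.hasFDerivAt.restrictScalars ℝ).comp z hf
  have e : wirt (G' * p) (G' * q) =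
      (((ContinuousLinearMap.toSpanSingleton ℂ G').restrictScalars ℝ).comp (wirt p q)) := by
    ext; simp; ring
  rw [HasWirt, e]
  exact h

lemma comp_rot {ζ : ℂ} (hf : HasWirt f p q (z * ζ)) :
    HasWirt (fun w => f (w * ζ)) (p * ζ) (q * starRingEnd ℂ ζ) z := by
  have h1 : HasFDerivAt (fun w : ℂ => w * ζ) (ζ • ContinuousLinearMap.id ℝ ℂ) z := by
    have := (hasFDerivAt_id (𝕜 := ℝ) z).mul_const ζ
    simpa using this
  have h := HasFDerivAt.comp (g := f) (f := fun w : ℂ => w * ζ) z hf h1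
  have e : wirt (p * ζ) (q * starRingEnd ℂ ζ) =
      (wirt p q).comp (ζ • ContinuousLinearMap.id ℝ ℂ) := by
    ext; simp; ring
  rw [HasWirt, e]
  exact h

lemma comp_curve {γ : ℝ → ℂ} {γ' : ℂ} {t : ℝ} (hf : HasWirt f p q (γ t)) (hγ : HasDerivAt γ γ' t) :
    HasDerivAt (fun s => f (γ s)) (p * γ' + q * starRingEnd ℂ γ') t := by
  have := HasFDerivAt.comp_hasDerivAt t hf hγ
  rwa [wirt_apply] at this

lemma congr (hf : HasWirt f p q z) (h : g =ᶠ[𝓝 z] f) : HasWirt g p q z :=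
  HasFDerivAt.congr_of_eventuallyEq hf h

lemma of_eq (hf : HasWirt f p q z) (hp : p = p') (hq : q = q') : HasWirt f p' q' z := by
  rw [← hp, ← hq]; exact hf

lemma of_differentiableAt (h : DifferentiableAt ℝ f z) : HasWirt f (dz f z) (dzbar f z) z := by
  have : wirt (dz f z) (dzbar f z) = fderiv ℝ f z := by
    ext v
    have hv : fderiv ℝ f z v = v.re * fderiv ℝ f z 1 + v.im * fderiv ℝ f z I := by
      conv_lhs => rw [show v = v.re • (1 : ℂ) + v.im • I by simp]
      rw [map_add, map_smul, map_smul]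
      simp
    have hc : conj v = v.re - v.im * I := by apply Complex.ext <;> simp
    have hr : v = v.re + v.im * I := (re_add_im v).symm
    rw [hv, wirt_apply, dz, dzbar, hc]
    linear_combination (1 / 2 * (fderiv ℝ f z 1 - I * fderiv ℝ f z I)) * hr -
      (v.im * fderiv ℝ f z I) * I_sq
  rw [HasWirt, this]
  exact h.hasFDerivAt

end HasWirt

lemma isOpen_disc : IsOpen disc := Metric.isOpen_ball

lemma mem_disc {z : ℂ} : z ∈ disc ↔ ‖z‖ < 1 := by simp [disc]

lemma dz_congr {u v : ℂ → ℂ} (h : EqOn u v disc) : EqOn (dz u) (dz v) disc := by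
  intro z hz
  have : u =ᶠ[𝓝 z] v := h.eventuallyEq_of_mem (isOpen_disc.mem_nhds hz)
  simp [dz, this.fderiv_eq]

lemma dzbar_congr {u v : ℂ → ℂ} (h : EqOn u v disc) : EqOn (dzbar u) (dzbar v) disc := by
  intro z hz
  have : u =ᶠ[𝓝 z] v := h.eventuallyEq_of_mem (isOpen_disc.mem_nhds hz)
  simp [dzbar, this.fderiv_eq]

lemma hasWirt_of_contDiffOn {N : ℂ → ℂ} {n : ℕ} (hN : ContDiffOn ℝ (n + 1 : ℕ) N disc) {z : ℂ}
    (hz : z ∈ disc) : HasWirt N (dz N z) (dzbar N z) z := by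
  apply HasWirt.of_differentiableAt
  exact ((hN.contDiffAt (isOpen_disc.mem_nhds hz)).differentiableAt (by simp))

lemma contDiffOn_fderiv {N : ℂ → ℂ} {n : ℕ} (hN : ContDiffOn ℝ (n + 1 : ℕ) N disc) :
    ContDiffOn ℝ n (fderiv ℝ N) disc :=
  hN.fderiv_of_isOpen isOpen_disc (by norm_cast)

lemma contDiffOn_dz {N : ℂ → ℂ} {n : ℕ} (hN : ContDiffOn ℝ (n + 1 : ℕ) N disc) :
    ContDiffOn ℝ n (dz N) disc := by
  have h := contDiffOn_fderiv hN
  unfold dz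
  exact contDiffOn_const.mul ((h.clm_apply contDiffOn_const).sub
    (contDiffOn_const.mul (h.clm_apply contDiffOn_const)))

lemma contDiffOn_dzbar {N : ℂ → ℂ} {n : ℕ} (hN : ContDiffOn ℝ (n + 1 : ℕ) N disc) :
    ContDiffOn ℝ n (dzbar N) disc := by
  have h := contDiffOn_fderiv hN
  unfold dzbar
  exact contDiffOn_const.mul ((h.clm_apply contDiffOn_const).add
    (contDiffOn_const.mul (h.clm_apply contDiffOn_const)))

/-! ### Averages of rotations and differentiation under the integral sign -/

/-- The average of the rotations `z ↦ N (z ζ(θ))` of `N` against the density `g`. -/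
def rotAvg (ζ : ℝ → ℂ) (N : ℂ → ℂ) (g : ℝ → ℂ) (z : ℂ) : ℂ :=
  ∫ θ in (0 : ℝ)..(2 * Real.pi), g θ * N (z * ζ θ)

section rotAvg

variable {ζ : ℝ → ℂ} {N : ℂ → ℂ} {g : ℝ → ℂ}

lemma mul_mem_disc (hζ1 : ∀ θ, ‖ζ θ‖ = 1) {z : ℂ} (hz : z ∈ disc) (θ : ℝ) : z * ζ θ ∈ disc := by
  rw [mem_disc] at *
  simpa [hζ1] using hz

lemma rotAvg_integrand_continuous (hζ : Continuous ζ) (hζ1 : ∀ θ, ‖ζ θ‖ = 1)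
    (hN : ContinuousOn N disc) (hg : Continuous g) :
    ContinuousOn (fun x : ℂ × ℝ => g x.2 * N (x.1 * ζ x.2)) (disc ×ˢ univ) := by
  refine (hg.comp continuous_snd).continuousOn.mul (hN.comp (by fun_prop) ?_)
  rintro ⟨z, θ⟩ ⟨hz, -⟩
  exact mul_mem_disc hζ1 hz θ

lemma rotAvg_integrand_continuous_right (hζ : Continuous ζ) (hζ1 : ∀ θ, ‖ζ θ‖ = 1)
    (hN : ContinuousOn N disc) (hg : Continuous g) {z : ℂ} (hz : z ∈ disc) :
    Continuous (fun θ => g θ * N (z * ζ θ)) := by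
  have := (rotAvg_integrand_continuous hζ hζ1 hN hg).comp (f := fun θ : ℝ => (z, θ))
    (s := univ) (by fun_prop) (fun θ _ => ⟨hz, trivial⟩)
  rwa [← continuousOn_univ]

/-- Supplies the constant dominating function, uniform near $z$, for dominated convergence: the
integrand is continuous on a compact neighbourhood times the period. -/
lemma exists_bound_integrand (hζ : Continuous ζ) (hζ1 : ∀ θ, ‖ζ θ‖ = 1)
    (hN : ContinuousOn N disc) (hg : Continuous g) {z : ℂ} (hz : z ∈ disc) :
    ∃ s ∈ 𝓝 z, s ⊆ disc ∧ ∃ C : ℝ, ∀ w ∈ s, ∀ θ ∈ Icc (0 : ℝ) (2 * Real.pi),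
      ‖g θ * N (w * ζ θ)‖ ≤ C := by
  obtain ⟨s, hs, hsd, hsc⟩ := local_compact_nhds (isOpen_disc.mem_nhds hz)
  refine ⟨s, hs, hsd, ?_⟩
  obtain ⟨C, hC⟩ := (hsc.prod (isCompact_Icc (a := (0 : ℝ)) (b := 2 * Real.pi))).exists_bound_of_continuousOn
    ((rotAvg_integrand_continuous hζ hζ1 hN hg).mono (prod_mono hsd (subset_univ _)))
  exact ⟨C, fun w hw θ hθ => hC (w, θ) ⟨hw, hθ⟩⟩

lemma uIoc_subset_Icc_two_pi : uIoc (0 : ℝ) (2 * Real.pi) ⊆ Icc (0 : ℝ) (2 * Real.pi) := by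
  rw [uIoc_of_le (by positivity)]; exact Ioc_subset_Icc_self

lemma continuousOn_rotAvg (hζ : Continuous ζ) (hζ1 : ∀ θ, ‖ζ θ‖ = 1)
    (hN : ContinuousOn N disc) (hg : Continuous g) : ContinuousOn (rotAvg ζ N g) disc := by
  intro z hz
  apply ContinuousAt.continuousWithinAt
  obtain ⟨s, hs, hsd, C, hC⟩ := exists_bound_integrand hζ hζ1 hN hg hz
  refine intervalIntegral.continuousAt_of_dominated_interval (bound := fun _ => C) ?_ ?_ ?_ ?_
  · filter_upwards [hs] with w hw
    exact (rotAvg_integrand_continuous_right hζ hζ1 hN hg (hsd hw)).aestronglyMeasurable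
  · filter_upwards [hs] with w hw
    exact ae_of_all _ fun θ hθ => hC w hw θ (uIoc_subset_Icc_two_pi hθ)
  · simp
  · refine ae_of_all _ fun θ _ => ?_
    refine continuousAt_const.mul (ContinuousAt.comp (g := N) ?_ (by fun_prop))
    exact hN.continuousAt (isOpen_disc.mem_nhds (mul_mem_disc hζ1 hz θ))

/-- The chain rule for $w\mapsto w\zeta$ produces the factors $\zeta$ and $\bar\zeta$. Absorbing
them into the density makes each derivative again a rotation average, so that the formula can be
iterated. -/
lemma hasWirt_rotAvg (hζ : Continuous ζ) (hζ1 : ∀ θ, ‖ζ θ‖ = 1)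
    (hN : ContDiffOn ℝ 1 N disc) (hg : Continuous g) {z : ℂ} (hz : z ∈ disc) :
    HasWirt (rotAvg ζ N g) (rotAvg ζ (dz N) (fun θ => g θ * ζ θ) z)
      (rotAvg ζ (dzbar N) (fun θ => g θ * conj (ζ θ)) z) z := by
  have hN1 : ContDiffOn ℝ ((0 : ℕ) + 1 : ℕ) N disc := by simpa using hN
  have c1 := (contDiffOn_dz hN1).continuousOn
  have c2 := (contDiffOn_dzbar hN1).continuousOn
  have g1 : Continuous (fun θ => g θ * ζ θ) := by fun_prop
  have g2 : Continuous (fun θ => g θ * conj (ζ θ)) := by fun_prop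
  obtain ⟨s, hs, hsd, C, hC⟩ := exists_bound_integrand hζ hζ1 c1 g1 hz
  obtain ⟨s', hs', hsd', C', hC'⟩ := exists_bound_integrand hζ hζ1 c2 g2 hz
  let F' : ℂ → ℝ → ℂ →L[ℝ] ℂ := fun w θ =>
    wirt ((g θ * ζ θ) * dz N (w * ζ θ)) ((g θ * conj (ζ θ)) * dzbar N (w * ζ θ))
  have wc : Continuous (fun x : ℂ × ℂ => wirt x.1 x.2) := by unfold wirt; fun_prop
  have i1 := rotAvg_integrand_continuous_right hζ hζ1 c1 g1 hz
  have i2 := rotAvg_integrand_continuous_right hζ hζ1 c2 g2 hz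
  have cF' : Continuous (F' z) := wc.comp (i1.prodMk i2)
  have key := intervalIntegral.hasFDerivAt_integral_of_dominated_of_fderiv_le (𝕜 := ℝ)
    (μ := volume) (a := 0) (b := 2 * Real.pi) (F := fun w θ => g θ * N (w * ζ θ)) (F' := F')
    (x₀ := z) (s := s ∩ s') (bound := fun _ => C + C') (inter_mem hs hs') ?_ ?_ ?_ ?_ ?_ ?_
  · have e : ∫ θ in (0 : ℝ)..(2 * Real.pi), F' z θ =
        wirt (rotAvg ζ (dz N) (fun θ => g θ * ζ θ) z)
          (rotAvg ζ (dzbar N) (fun θ => g θ * conj (ζ θ)) z) := by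
      ext v
      all_goals
        rw [ContinuousLinearMap.intervalIntegral_apply (cF'.intervalIntegrable _ _)]
        simp only [F', wirt_apply]
        rw [intervalIntegral.integral_add, intervalIntegral.integral_mul_const,
          intervalIntegral.integral_mul_const]
        · rfl
        · exact (i1.mul continuous_const).intervalIntegrable _ _
        · exact (i2.mul continuous_const).intervalIntegrable _ _
    rw [e] at key
    exact key
  · filter_upwards [hs] with w hw
    exact (rotAvg_integrand_continuous_right hζ hζ1 hN.continuousOn hg
      (hsd hw)).aestronglyMeasurable
  · exact (rotAvg_integrand_continuous_right hζ hζ1 hN.continuousOn hg hz).intervalIntegrable _ _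
  · exact cF'.aestronglyMeasurable
  · refine ae_of_all _ fun θ hθ w hw => ?_
    have hθ' := uIoc_subset_Icc_two_pi hθ
    have h1 := hC w hw.1 θ hθ'
    have h2 := hC' w hw.2 θ hθ'
    refine ContinuousLinearMap.opNorm_le_bound _ (by linarith [norm_nonneg (g θ * ζ θ * dz N (w * ζ θ)), norm_nonneg (g θ * conj (ζ θ) * dzbar N (w * ζ θ))]) fun v => ?_
    simp only [F', wirt_apply]
    refine (norm_add_le _ _).trans ?_
    rw [norm_mul, norm_mul _ (conj v), RCLike.norm_conj, ← add_mul]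
    gcongr
  · simp
  · refine ae_of_all _ fun θ _ w hw => ?_
    have h := ((hasWirt_of_contDiffOn hN1 (mul_mem_disc hζ1 (hsd hw.1) θ)).comp_rot).const_mul (g θ)
    exact h.of_eq (by ring) (by ring)

lemma contDiffOn_of_hasWirt {n : ℕ} {f p q : ℂ → ℂ} (h : ∀ z ∈ disc, HasWirt f (p z) (q z) z)
    (hp : ContDiffOn ℝ n p disc) (hq : ContDiffOn ℝ n q disc) :
    ContDiffOn ℝ (n + 1 : ℕ) f disc := by
  push_cast
  rw [contDiffOn_succ_iff_fderiv_of_isOpen isOpen_disc]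
  refine ⟨fun z hz => (HasFDerivAt.differentiableAt (h z hz)).differentiableWithinAt, by simp, ?_⟩
  have : ContDiffOn ℝ n (fun z => wirt (p z) (q z)) disc := by
    unfold wirt
    exact (hp.smul contDiffOn_const).add (hq.smul contDiffOn_const)
  exact this.congr fun z hz => HasFDerivAt.fderiv (h z hz)

lemma contDiffOn_rotAvg (n : ℕ) (hζ : Continuous ζ) (hζ1 : ∀ θ, ‖ζ θ‖ = 1)
    (hN : ContDiffOn ℝ n N disc) (hg : Continuous g) : ContDiffOn ℝ n (rotAvg ζ N g) disc := by
  induction n generalizing N g with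
  | zero =>
    simp only [Nat.cast_zero, contDiffOn_zero] at *
    exact continuousOn_rotAvg hζ hζ1 hN hg
  | succ n ih =>
    refine contDiffOn_of_hasWirt
      (fun z hz => hasWirt_rotAvg hζ hζ1 (hN.of_le (by norm_cast; omega)) hg hz) ?_ ?_
    · exact ih (contDiffOn_dz hN) (by fun_prop)
    · exact ih (contDiffOn_dzbar hN) (by fun_prop)

end rotAvg

/-! ### The weight, the kernel, and the equation for the kernel -/

lemma one_sub_norm_sq_pos {z : ℂ} (hz : z ∈ disc) : 0 < 1 - ‖z‖ ^ 2 := by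
  rw [mem_disc] at hz
  nlinarith [norm_nonneg z]

lemma ofReal_one_sub_norm_sq (z : ℂ) : ((1 - ‖z‖ ^ 2 : ℝ) : ℂ) = 1 - z * conj z := by
  rw [mul_conj, normSq_eq_norm_sq]
  push_cast
  ring

lemma conj_mem_disc {z : ℂ} (hz : z ∈ disc) : conj z ∈ disc := by
  rw [mem_disc] at *
  rwa [RCLike.norm_conj]

lemma one_sub_mem_slitPlane {z : ℂ} (hz : z ∈ disc) : 1 - z ∈ slitPlane := by
  left
  rw [mem_disc] at hz
  have := (le_abs_self z.re).trans (abs_re_le_norm z)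
  simp
  linarith

lemma one_sub_ne_zero {z : ℂ} (hz : z ∈ disc) : 1 - z ≠ 0 :=
  slitPlane_ne_zero (one_sub_mem_slitPlane hz)

lemma weight_ne_zero (e : ℝ) {z : ℂ} (hz : z ∈ disc) : weight e z ≠ 0 :=
  ofReal_ne_zero.2 (Real.rpow_pos_of_pos (one_sub_norm_sq_pos hz) e).ne'

lemma weight_add_one (e : ℝ) {z : ℂ} (hz : z ∈ disc) :
    weight (e + 1) z = weight e z * (1 - z * conj z) := by
  rw [weight, Real.rpow_add_one (one_sub_norm_sq_pos hz).ne', ofReal_mul, ofReal_one_sub_norm_sq,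
    weight]

lemma hasWirt_one_sub_mul_conj (z : ℂ) :
    HasWirt (fun w => 1 - w * conj w) (-conj z) (-z) z := by
  have h := (HasWirt.const 1 z).add (((HasWirt.id z).mul (HasWirt.conjugate z)).const_mul (-1))
  refine (h.congr (.of_forall fun w => ?_)).of_eq ?_ ?_ <;> simp
  ring

/-- The exponent is $e+1$ because the kernel carries $\omega_{\alpha+1}$. Its derivatives then
contain $\omega_\alpha$, exactly the factor cancelled by $\omega_\alpha^{-1}$ in $T_\alpha$. -/
lemma hasWirt_weight (e : ℝ) {z : ℂ} (hz : z ∈ disc) :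
    HasWirt (weight (e + 1)) (-(e + 1) * weight e z * conj z) (-(e + 1) * weight e z * z) z := by
  have hs : (1 : ℂ) - z * conj z ∈ slitPlane := by
    rw [← ofReal_one_sub_norm_sq]
    exact ofReal_mem_slitPlane.2 (one_sub_norm_sq_pos hz)
  have hd : HasDerivAt (fun y : ℂ => y ^ ((e + 1 : ℝ) : ℂ))
      (((e + 1 : ℝ) : ℂ) * (1 - z * conj z) ^ (((e + 1 : ℝ) : ℂ) - 1) * 1) (1 - z * conj z) :=
    (hasDerivAt_id _).cpow_const hs
  have h := HasWirt.comp_holo (f := fun w => 1 - w * conj w) hd (hasWirt_one_sub_mul_conj z)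
  have e1 : (1 - z * conj z) ^ (((e + 1 : ℝ) : ℂ) - 1) = weight e z := by
    rw [weight, ofReal_cpow (one_sub_norm_sq_pos hz).le, ofReal_one_sub_norm_sq]
    push_cast
    ring_nf
  rw [e1] at h
  refine (h.congr ?_).of_eq (by push_cast; ring) (by push_cast; ring)
  filter_upwards [isOpen_disc.mem_nhds hz] with w hw
  rw [weight, ofReal_cpow (one_sub_norm_sq_pos hw).le, ofReal_one_sub_norm_sq]

lemma contDiffOn_weight (e : ℝ) (n : ℕ) : ContDiffOn ℝ n (weight e) disc := by
  have h1 : ContDiffOn ℝ n (fun z : ℂ => (1 - ‖z‖ ^ 2) ^ e) disc := by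
    intro z hz
    apply ContDiffAt.contDiffWithinAt
    apply ContDiffAt.rpow_const_of_ne
    · exact contDiffAt_const.sub (contDiff_norm_sq ℝ).contDiffAt
    · exact (one_sub_norm_sq_pos hz).ne'
  exact ofRealCLM.contDiff.comp_contDiffOn h1

/-- The factor `(1-z)^{-s} (1-z̄)^{-s}` of the Poisson kernel. -/
def kernelFactor (s : ℝ) (z : ℂ) : ℂ := (1 - z) ^ (-s : ℂ) * (1 - conj z) ^ (-s : ℂ)

lemma hasWirt_kernelFactor (s : ℝ) {z : ℂ} (hz : z ∈ disc) :
    HasWirt (kernelFactor s) (s * kernelFactor s z * (1 - z)⁻¹)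
      (s * kernelFactor s z * (1 - conj z)⁻¹) z := by
  have hd : ∀ y ∈ disc, HasDerivAt (fun y : ℂ => (1 - y) ^ (-s : ℂ))
      (s * (1 - y) ^ (-s : ℂ) * (1 - y)⁻¹) y := by
    intro y hy
    have h : HasDerivAt (fun y : ℂ => (1 - y) ^ (-s : ℂ)) (-s * (1 - y) ^ (-s - 1 : ℂ) * -1) y :=
      ((hasDerivAt_id y).const_sub 1).cpow_const (c := (-s : ℂ)) (one_sub_mem_slitPlane hy)
    convert h using 1
    rw [cpow_sub _ _ (one_sub_ne_zero hy), cpow_one]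
    field_simp
  have h1 := HasWirt.comp_holo (f := fun w => w) (hd z hz) (HasWirt.id z)
  have h2 := HasWirt.comp_holo (f := fun w => conj w) (hd _ (conj_mem_disc hz)) (HasWirt.conjugate z)
  refine (h1.mul h2).of_eq ?_ ?_ <;> simp only [kernelFactor] <;> ring

lemma contDiffOn_kernelFactor (s : ℝ) (n : ℕ) : ContDiffOn ℝ n (kernelFactor s) disc := by
  have h1 : ∀ y ∈ disc, ContDiffAt ℝ n (fun y : ℂ => (1 - y) ^ (-s : ℂ)) y := by
    intro y hy
    have : AnalyticAt ℂ (fun y : ℂ => (1 - y) ^ (-s : ℂ)) y :=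
      AnalyticAt.cpow (analyticAt_const.sub analyticAt_id) analyticAt_const
        (one_sub_mem_slitPlane hy)
    exact this.contDiffAt.restrict_scalars ℝ
  intro z hz
  apply ContDiffAt.contDiffWithinAt
  refine (h1 z hz).mul ?_
  exact ContDiffAt.comp z (h1 (conj z) (conj_mem_disc hz)) conjCLE.contDiff.contDiffAt

lemma poissonKernel_eq (α : ℝ) (z : ℂ) :
    poissonKernel (α / 2) (α / 2) z =
      poissonConst (α / 2) (α / 2) * (weight (α + 1) z * kernelFactor (α / 2 + 1) z) := by
  rw [poissonKernel, weight, kernelFactor, add_halves, cpow_neg, cpow_neg, div_eq_mul_inv, mul_inv]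
  push_cast
  ring

lemma contDiffOn_poissonKernel (α : ℝ) (n : ℕ) :
    ContDiffOn ℝ n (poissonKernel (α / 2) (α / 2)) disc :=
  ((contDiffOn_const (c := (poissonConst (α / 2) (α / 2) : ℂ))).mul
    ((contDiffOn_weight (α + 1) n).mul (contDiffOn_kernelFactor (α / 2 + 1) n))).congr
    fun z _ => poissonKernel_eq α z

lemma hasWirt_poissonKernel (α : ℝ) {z : ℂ} (hz : z ∈ disc) :
    HasWirt (poissonKernel (α / 2) (α / 2))
      (poissonConst (α / 2) (α / 2) * weight α z * kernelFactor (α / 2 + 1) z *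
        (-(α + 1) * conj z + (α / 2 + 1) * (1 - z * conj z) * (1 - z)⁻¹))
      (poissonConst (α / 2) (α / 2) * weight α z * kernelFactor (α / 2 + 1) z *
        (-(α + 1) * z + (α / 2 + 1) * (1 - z * conj z) * (1 - conj z)⁻¹)) z := by
  have h := ((hasWirt_weight α hz).mul (hasWirt_kernelFactor (α / 2 + 1) hz)).const_mul
    (poissonConst (α / 2) (α / 2) : ℂ)
  refine (h.congr (.of_forall fun w => poissonKernel_eq α w)).of_eq ?_ ?_ <;>
  · rw [weight_add_one α hz]
    push_cast
    ring

/-- Once $\omega_\alpha^{-1}$ has cancelled, a second differentiation leaves the common factor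
`kernelFactor` times rational functions of $z$ and $\bar z$, so the equation is an algebraic
identity. -/
lemma opT_poissonKernel (α : ℝ) {z : ℂ} (hz : z ∈ disc) :
    opT α (poissonKernel (α / 2) (α / 2)) z = 0 := by
  set c : ℂ := ((poissonConst (α / 2) (α / 2) : ℝ) : ℂ) with hc
  set s : ℂ := α / 2 + 1 with hs
  have hinv : HasWirt (fun w => (1 - w)⁻¹) (((1 - z)⁻¹) ^ 2) 0 z := by
    have hd := ((hasDerivAt_id z).const_sub 1).inv (one_sub_ne_zero hz)
    refine (HasWirt.comp_holo (f := fun w => w) hd (HasWirt.id z)).of_eq ?_ ?_ <;> simp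
  have hinv' : HasWirt (fun w => (1 - conj w)⁻¹) 0 (((1 - conj z)⁻¹) ^ 2) z := by
    have hd := ((hasDerivAt_id (conj z)).const_sub 1).inv (one_sub_ne_zero (conj_mem_disc hz))
    refine (HasWirt.comp_holo (f := fun w => conj w) hd (HasWirt.conjugate z)).of_eq ?_ ?_ <;> simp
  have hL : HasWirt (fun w => (weight α w)⁻¹ * dzbar (poissonKernel (α / 2) (α / 2)) w) _ _ z :=
    ((((hasWirt_kernelFactor (α / 2 + 1) hz).mul (((HasWirt.id z).const_mul (-(α + 1) : ℂ)).add
      (((hasWirt_one_sub_mul_conj z).mul hinv').const_mul s))).const_mul c).congr (by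
      filter_upwards [isOpen_disc.mem_nhds hz] with w hw
      rw [(hasWirt_poissonKernel α hw).dzbar_eq, ← hc, ← hs, mul_assoc, mul_left_comm, mul_assoc c,
        mul_inv_cancel_left₀ (weight_ne_zero α hw)]
      ring))
  have hL' : HasWirt (fun w => (weight α w)⁻¹ * dz (poissonKernel (α / 2) (α / 2)) w) _ _ z :=
    ((((hasWirt_kernelFactor (α / 2 + 1) hz).mul (((HasWirt.conjugate z).const_mul (-(α + 1) : ℂ)).add
      (((hasWirt_one_sub_mul_conj z).mul hinv).const_mul s))).const_mul c).congr (by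
      filter_upwards [isOpen_disc.mem_nhds hz] with w hw
      rw [(hasWirt_poissonKernel α hw).dz_eq, ← hc, ← hs, mul_assoc, mul_left_comm, mul_assoc c,
        mul_inv_cancel_left₀ (weight_ne_zero α hw)]
      ring))
  rw [opT, opL, opLstar, hL.dz_eq, hL'.dzbar_eq, poissonKernel_eq]
  have h1 := weight_ne_zero (α + 1) hz
  have h2 := one_sub_ne_zero hz
  have h3 := one_sub_ne_zero (conj_mem_disc hz)
  generalize kernelFactor (α / 2 + 1) z = P
  generalize weight (α + 1) z = W at *
  push_cast
  rw [← hs, ← hc]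
  have hα : (α : ℂ) = 2 * s - 2 := by rw [hs]; ring
  rw [hα]
  -- The identity holds with $z$ and $\bar z$ as independent variables.
  generalize conj z = y at *
  field_simp
  ring

/-! ### Rotation invariance and harmonicity of Poisson integrals -/

/-- `θ ↦ e^{-iθ}`. -/
def rotNeg (θ : ℝ) : ℂ := exp (-(θ * I))

lemma continuous_rotNeg : Continuous rotNeg := by unfold rotNeg; fun_prop

lemma norm_rotNeg (θ : ℝ) : ‖rotNeg θ‖ = 1 := by
  rw [rotNeg, ← neg_mul, ← ofReal_neg, norm_exp_ofReal_mul_I]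

lemma weight_mul_of_norm_one (e : ℝ) (z : ℂ) {ζ : ℂ} (hζ : ‖ζ‖ = 1) :
    weight e (z * ζ) = weight e z := by
  simp [weight, hζ]

/-- Each second-order term of $T_\alpha$ contains one $\partial_z$ and one $\partial_{\bar z}$, so
the rotation contributes $\zeta\bar\zeta=1$. The weights are radial and unaffected. -/
lemma opT_rotAvg (α : ℝ) {ζ : ℝ → ℂ} {N : ℂ → ℂ} {g : ℝ → ℂ} (hζ : Continuous ζ)
    (hζ1 : ∀ θ, ‖ζ θ‖ = 1) (hN : ContDiffOn ℝ 2 N disc) (hg : Continuous g)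
    {z : ℂ} (hz : z ∈ disc) : opT α (rotAvg ζ N g) z = rotAvg ζ (opT α N) g z := by
  have hw : ContDiffOn ℝ (1 : ℕ) (fun w => (weight α w)⁻¹) disc :=
    (contDiffOn_weight α 1).inv fun w hw => weight_ne_zero α hw
  have hN2 : ContDiffOn ℝ ((1 : ℕ) + 1 : ℕ) N disc := by exact_mod_cast hN
  have hN1 : ContDiffOn ℝ 1 N disc := hN.of_le (by norm_num)
  have k1 : ContDiffOn ℝ 1 (fun w => (weight α w)⁻¹ * dzbar N w) disc := by
    exact_mod_cast hw.mul (contDiffOn_dzbar hN2)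
  have k2 : ContDiffOn ℝ 1 (fun w => (weight α w)⁻¹ * dz N w) disc := by
    exact_mod_cast hw.mul (contDiffOn_dz hN2)
  have hone : ∀ θ, ζ θ * conj (ζ θ) = 1 := fun θ => by
    rw [mul_conj, normSq_eq_norm_sq, hζ1]; simp
  have hL : opL α (rotAvg ζ N g) z = rotAvg ζ (opL α N) g z := by
    have e : EqOn (fun w => (weight α w)⁻¹ * dzbar (rotAvg ζ N g) w)
        (rotAvg ζ (fun w => (weight α w)⁻¹ * dzbar N w) (fun θ => g θ * conj (ζ θ))) disc := by
      intro w hw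
      simp only
      rw [(hasWirt_rotAvg hζ hζ1 hN1 hg hw).dzbar_eq, rotAvg, rotAvg,
        ← intervalIntegral.integral_const_mul]
      congr 1 with θ
      rw [weight_mul_of_norm_one _ _ (hζ1 θ)]
      ring
    rw [opL, dz_congr e hz, (hasWirt_rotAvg hζ hζ1 k1 (by fun_prop) hz).dz_eq]
    simp only [rotAvg, opL]
    congr 1 with θ
    linear_combination (g θ * dz (fun w => (weight α w)⁻¹ * dzbar N w) (z * ζ θ)) * hone θ
  have hL' : opLstar α (rotAvg ζ N g) z = rotAvg ζ (opLstar α N) g z := by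
    have e : EqOn (fun w => (weight α w)⁻¹ * dz (rotAvg ζ N g) w)
        (rotAvg ζ (fun w => (weight α w)⁻¹ * dz N w) (fun θ => g θ * ζ θ)) disc := by
      intro w hw
      simp only
      rw [(hasWirt_rotAvg hζ hζ1 hN1 hg hw).dz_eq, rotAvg, rotAvg,
        ← intervalIntegral.integral_const_mul]
      congr 1 with θ
      rw [weight_mul_of_norm_one _ _ (hζ1 θ)]
      ring
    rw [opLstar, dzbar_congr e hz, (hasWirt_rotAvg hζ hζ1 k2 (by fun_prop) hz).dzbar_eq]
    simp only [rotAvg, opLstar]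
    congr 1 with θ
    linear_combination (g θ * dzbar (fun w => (weight α w)⁻¹ * dz N w) (z * ζ θ)) * hone θ
  have k1' : ContDiffOn ℝ ((0 : ℕ) + 1 : ℕ) (fun w => (weight α w)⁻¹ * dzbar N w) disc := by
    simpa using k1
  have k2' : ContDiffOn ℝ ((0 : ℕ) + 1 : ℕ) (fun w => (weight α w)⁻¹ * dz N w) disc := by
    simpa using k2
  have i0 := rotAvg_integrand_continuous_right hζ hζ1 hN.continuousOn hg hz
  have i1 := rotAvg_integrand_continuous_right hζ hζ1 (contDiffOn_dz k1').continuousOn hg hz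
  have i2 := rotAvg_integrand_continuous_right hζ hζ1 (contDiffOn_dzbar k2').continuousOn hg hz
  rw [opT, hL, hL']
  simp only [rotAvg, opL, opLstar]
  rw [← intervalIntegral.integral_add (i1.intervalIntegrable _ _) (i2.intervalIntegrable _ _),
    ← intervalIntegral.integral_const_mul, ← intervalIntegral.integral_const_mul,
    ← intervalIntegral.integral_add]
  · congr 1 with θ
    rw [opT, weight_mul_of_norm_one _ _ (hζ1 θ)]
    simp only [opL, opLstar]
    ring
  · exact (i0.const_mul _).intervalIntegrable _ _
  · exact ((i1.add i2).const_mul _).intervalIntegrable _ _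

lemma poissonIntegral_eq_rotAvg (α β : ℝ) (f : Circle → ℂ) :
    poissonIntegral α β f = rotAvg rotNeg (poissonKernel α β)
      (fun θ => (1 / (2 * Real.pi) : ℂ) * f (Circle.exp θ)) := by
  ext z
  rw [poissonIntegral, rotAvg, ← intervalIntegral.integral_const_mul]
  congr 1 with θ
  rw [rotNeg]
  ring

lemma isTHarmonic_poissonIntegral (α : ℝ) {f : Circle → ℂ}
    (hf : Continuous fun θ : ℝ => f (Circle.exp θ)) :
    IsTHarmonic α (poissonIntegral (α / 2) (α / 2) f) := by
  have hK : ContDiffOn ℝ 2 (poissonKernel (α / 2) (α / 2)) disc := by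
    exact_mod_cast contDiffOn_poissonKernel α 2
  have hg : Continuous fun θ : ℝ => (1 / (2 * Real.pi) : ℂ) * f (Circle.exp θ) :=
    continuous_const.mul hf
  rw [poissonIntegral_eq_rotAvg]
  refine ⟨?_, fun z hz => ?_⟩
  · exact_mod_cast contDiffOn_rotAvg 2 continuous_rotNeg norm_rotNeg (by exact_mod_cast hK)
      hg
  · rw [opT_rotAvg α continuous_rotNeg norm_rotNeg hK hg hz, rotAvg]
    simp [opT_poissonKernel α (mul_mem_disc norm_rotNeg hz _)]

lemma IsTHarmonic.congr {α : ℝ} {u v : ℂ → ℂ} (hu : IsTHarmonic α u) (h : EqOn v u disc) :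
    IsTHarmonic α v := by
  refine ⟨hu.1.congr h, fun z hz => ?_⟩
  have h1 : opL α v z = opL α u z :=
    dz_congr (fun w hw => by rw [dzbar_congr h hw]) hz
  have h2 : opLstar α v z = opLstar α u z :=
    dzbar_congr (fun w hw => by rw [dz_congr h hw]) hz
  rw [opT, h1, h2, h hz, ← opT, hu.2 z hz]

/-! ### Fourier modes on circles -/

/-- `θ ↦ e^{iθ}`. -/
def rotPos (θ : ℝ) : ℂ := exp (θ * I)

lemma continuous_rotPos : Continuous rotPos := by unfold rotPos; fun_prop

lemma norm_rotPos (θ : ℝ) : ‖rotPos θ‖ = 1 := norm_exp_ofReal_mul_I θ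

lemma conj_rotPos (θ : ℝ) : conj (rotPos θ) = exp (-(θ * I)) := by
  rw [rotPos, ← exp_conj]; simp

lemma hasDerivAt_rotPos (θ : ℝ) : HasDerivAt rotPos (rotPos θ * I) θ := by
  have h : HasDerivAt (fun t : ℝ => (t : ℂ) * I) (1 * I) θ :=
    (hasDerivAt_id θ).ofReal_comp.mul_const I
  exact h.cexp.congr_deriv (by rw [one_mul]; rfl)

/-- `θ ↦ e^{-inθ}`. -/
def expMode (n : ℤ) (θ : ℝ) : ℂ := exp (-(n * θ * I))

lemma continuous_expMode (n : ℤ) : Continuous (expMode n) := by unfold expMode; fun_prop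

lemma norm_expMode (n : ℤ) (θ : ℝ) : ‖expMode n θ‖ = 1 := by
  have : -(n * θ * I : ℂ) = ((-(n * θ) : ℝ) : ℂ) * I := by push_cast; ring
  rw [expMode, this, norm_exp_ofReal_mul_I]

lemma expMode_mul_rotPos (n : ℤ) (θ : ℝ) : expMode n θ * rotPos θ = expMode (n - 1) θ := by
  rw [expMode, rotPos, ← exp_add, expMode]; congr 1; push_cast; ring

lemma expMode_mul_conj_rotPos (n : ℤ) (θ : ℝ) :
    expMode n θ * conj (rotPos θ) = expMode (n + 1) θ := by
  rw [expMode, conj_rotPos, ← exp_add, expMode]; congr 1; push_cast; ring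

lemma hasDerivAt_expMode (n : ℤ) (θ : ℝ) : HasDerivAt (expMode n) (-(n * I) * expMode n θ) θ := by
  have h : HasDerivAt (fun t : ℝ => -((n : ℂ) * t * I)) (-((n : ℂ) * 1 * I)) θ :=
    (((hasDerivAt_id θ).ofReal_comp.const_mul (n : ℂ)).mul_const I).neg
  exact h.cexp.congr_deriv (by simp only [expMode]; ring)

lemma expMode_two_pi (n : ℤ) : expMode n (2 * Real.pi) = expMode n 0 := by
  rw [expMode, expMode, exp_eq_exp_iff_exists_int]
  exact ⟨-n, by push_cast; ring⟩

lemma rotPos_two_pi : rotPos (2 * Real.pi) = rotPos 0 := by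
  simp [rotPos]

/-- `2π` times the `n`-th Fourier coefficient of `v` on the circle of radius `r`. -/
def mode (v : ℂ → ℂ) (n : ℤ) (r : ℝ) : ℂ := rotAvg rotPos v (expMode n) r

lemma ofReal_mem_disc {r : ℝ} (hr : r ∈ Ioo (-1 : ℝ) 1) : (r : ℂ) ∈ disc := by
  rw [mem_disc, norm_real, Real.norm_eq_abs, abs_lt]; exact hr

lemma continuousOn_mode {v : ℂ → ℂ} (hv : ContinuousOn v disc) (n : ℤ) :
    ContinuousOn (mode v n) (Ioo (-1) 1) :=
  (continuousOn_rotAvg continuous_rotPos norm_rotPos hv (continuous_expMode n)).comp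
    continuous_ofReal.continuousOn fun _ hr => ofReal_mem_disc hr

lemma norm_mode_le {v : ℂ → ℂ} {n : ℤ} {r C : ℝ} (h : ∀ θ, ‖v (r * rotPos θ)‖ ≤ C) :
    ‖mode v n r‖ ≤ C * (2 * Real.pi) := by
  have := intervalIntegral.norm_integral_le_of_norm_le_const (a := 0) (b := 2 * Real.pi) (C := C)
    (f := fun θ => expMode n θ * v (r * rotPos θ)) fun θ _ => by
      rw [norm_mul, norm_expMode, one_mul]; exact h θ
  rwa [sub_zero, abs_of_pos (by positivity)] at this

/-- Since $\partial_r=e^{i\theta}\partial_z+e^{-i\theta}\partial_{\bar z}$, the exponentials shift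
the index by one in opposite directions. -/
lemma hasDerivAt_mode {v : ℂ → ℂ} (hv : ContDiffOn ℝ 1 v disc) (n : ℤ) {r : ℝ}
    (hr : r ∈ Ioo (-1 : ℝ) 1) :
    HasDerivAt (mode v n) (mode (dz v) (n - 1) r + mode (dzbar v) (n + 1) r) r := by
  have h := (hasWirt_rotAvg continuous_rotPos norm_rotPos hv (continuous_expMode n)
    (ofReal_mem_disc hr)).comp_curve (hasDerivAt_id r).ofReal_comp
  simp only [expMode_mul_rotPos, expMode_mul_conj_rotPos] at h
  exact h.congr_deriv (by simp [mode])

/-- The angular counterpart of `hasDerivAt_mode`: the $\theta$-derivative of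
$e^{-in\theta}v(re^{i\theta})$ integrates to zero over a period. -/
lemma mode_angular {v : ℂ → ℂ} (hv : ContDiffOn ℝ 1 v disc) (n : ℤ) {r : ℝ}
    (hr : r ∈ Ioo (-1 : ℝ) 1) :
    r * (mode (dz v) (n - 1) r - mode (dzbar v) (n + 1) r) = n * mode v n r := by
  have hv' : ContDiffOn ℝ ((0 : ℕ) + 1 : ℕ) v disc := by simpa using hv
  have hz := ofReal_mem_disc hr
  have i0 := rotAvg_integrand_continuous_right continuous_rotPos norm_rotPos
    hv.continuousOn (continuous_expMode n) hz
  have i1 := rotAvg_integrand_continuous_right continuous_rotPos norm_rotPos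
    (contDiffOn_dz hv').continuousOn (continuous_expMode (n - 1)) hz
  have i2 := rotAvg_integrand_continuous_right continuous_rotPos norm_rotPos
    (contDiffOn_dzbar hv').continuousOn (continuous_expMode (n + 1)) hz
  have hd : ∀ θ : ℝ, HasDerivAt (fun θ => expMode n θ * v (r * rotPos θ))
      (I * (r * (expMode (n - 1) θ * dz v (r * rotPos θ)) -
        r * (expMode (n + 1) θ * dzbar v (r * rotPos θ)) -
        n * (expMode n θ * v (r * rotPos θ)))) θ := by
    intro θ
    have h1 := (hasWirt_of_contDiffOn hv' (mul_mem_disc norm_rotPos hz θ)).comp_curve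
      (γ := fun θ => r * rotPos θ) ((hasDerivAt_rotPos θ).const_mul (r : ℂ))
    refine ((hasDerivAt_expMode n θ).mul h1).congr_deriv ?_
    rw [← expMode_mul_rotPos, ← expMode_mul_conj_rotPos]
    simp only [map_mul, conj_I, conj_ofReal]
    ring
  have ftc := intervalIntegral.integral_eq_sub_of_hasDerivAt (a := 0) (b := 2 * Real.pi)
    (fun θ _ => hd θ) (((((i1.const_mul _).sub (i2.const_mul _)).sub
      (i0.const_mul _)).const_mul _).intervalIntegrable _ _)
  rw [expMode_two_pi, rotPos_two_pi, sub_self, intervalIntegral.integral_const_mul,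
    intervalIntegral.integral_sub, intervalIntegral.integral_sub,
    intervalIntegral.integral_const_mul, intervalIntegral.integral_const_mul,
    intervalIntegral.integral_const_mul] at ftc
  · have := (mul_eq_zero.1 ftc).resolve_left I_ne_zero
    simp only [mode, rotAvg]
    linear_combination this
  · exact (i1.const_mul _).intervalIntegrable _ _
  · exact (i2.const_mul _).intervalIntegrable _ _
  · exact ((i1.const_mul _).sub (i2.const_mul _)).intervalIntegrable _ _
  · exact (i0.const_mul _).intervalIntegrable _ _

lemma mode_weight_inv_mul (e : ℝ) (v : ℂ → ℂ) (n : ℤ) (r : ℝ) :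
    mode (fun z => (weight e z)⁻¹ * v z) n r = (weight e r)⁻¹ * mode v n r := by
  rw [mode, rotAvg, mode, rotAvg, ← intervalIntegral.integral_const_mul]
  congr 1 with θ
  rw [weight_mul_of_norm_one _ _ (norm_rotPos θ)]
  ring

/-! ### The radial ODE of a mode and its flux -/

/-- The radial flux `r ω_α(r)⁻¹ U'(r)` of the `n`-th mode `U` of `u`. -/
def flux (α : ℝ) (u : ℂ → ℂ) (n : ℤ) (r : ℝ) : ℂ :=
  r * (mode (fun z => (weight α z)⁻¹ * dz u z) (n - 1) r +
    mode (fun z => (weight α z)⁻¹ * dzbar u z) (n + 1) r)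

lemma weight_ofReal (e r : ℝ) : weight e r = (((1 - r ^ 2) ^ e : ℝ) : ℂ) := by
  simp [weight]

lemma flux_eq (α : ℝ) (u : ℂ → ℂ) (n : ℤ) (r : ℝ) :
    flux α u n r = r * (weight α r)⁻¹ * (mode (dz u) (n - 1) r + mode (dzbar u) (n + 1) r) := by
  rw [flux, mode_weight_inv_mul, mode_weight_inv_mul]
  ring

namespace IsTHarmonic

variable {α : ℝ} {u : ℂ → ℂ} (hu : IsTHarmonic α u)
include hu

lemma contDiffOn_one : ContDiffOn ℝ 1 u disc := hu.1.of_le (by norm_num)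

lemma contDiffOn_weight_inv_dz : ContDiffOn ℝ 1 (fun z => (weight α z)⁻¹ * dz u z) disc := by
  have h : ContDiffOn ℝ ((1 : ℕ) + 1 : ℕ) u disc := by exact_mod_cast hu.1
  exact_mod_cast ((contDiffOn_weight α 1).inv fun w hw => weight_ne_zero α hw).mul
    (contDiffOn_dz h)

lemma contDiffOn_weight_inv_dzbar : ContDiffOn ℝ 1 (fun z => (weight α z)⁻¹ * dzbar u z) disc := by
  have h : ContDiffOn ℝ ((1 : ℕ) + 1 : ℕ) u disc := by exact_mod_cast hu.1
  exact_mod_cast ((contDiffOn_weight α 1).inv fun w hw => weight_ne_zero α hw).mul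
    (contDiffOn_dzbar h)

lemma continuousOn_dz : ContinuousOn (dz u) disc :=
  (contDiffOn_dz (n := 1) (by exact_mod_cast hu.1)).continuousOn

lemma continuousOn_dzbar : ContinuousOn (dzbar u) disc :=
  (contDiffOn_dzbar (n := 1) (by exact_mod_cast hu.1)).continuousOn

/-- The $n$-th mode of $T_\alpha u=0$ yields the $\alpha^2$ term, and applying `mode_angular` twice
yields the $n^2$ term. With `hasDerivAt_mode_flux` this is a first-order system with real
coefficients, positive for $\alpha\ne0$. -/
lemma hasDerivAt_flux (n : ℤ) {r : ℝ} (hr : r ∈ Ioo (0 : ℝ) 1) :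
    HasDerivAt (flux α u n)
      (((r * α ^ 2 * ((1 - r ^ 2) ^ (α + 1))⁻¹ + ((1 - r ^ 2) ^ α)⁻¹ * n ^ 2 / r : ℝ) : ℂ) *
        mode u n r) r := by
  have hr' : r ∈ Ioo (-1 : ℝ) 1 := ⟨by linarith [hr.1], hr.2⟩
  have h1 := hasDerivAt_mode hu.contDiffOn_weight_inv_dz (n - 1) hr'
  have h2 := hasDerivAt_mode hu.contDiffOn_weight_inv_dzbar (n + 1) hr'
  have a1 := mode_angular hu.contDiffOn_weight_inv_dz (n - 1) hr'
  have a2 := mode_angular hu.contDiffOn_weight_inv_dzbar (n + 1) hr'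
  have a3 := mode_angular hu.contDiffOn_one n hr'
  rw [sub_add_cancel] at h1 a1
  rw [add_sub_cancel_right] at h2 a2
  -- The equation $T_\alpha u=0$, integrated against $e^{-in\theta}$ over the circle.
  have hL : mode (dz fun z => (weight α z)⁻¹ * dzbar u z) n r +
      mode (dzbar fun z => (weight α z)⁻¹ * dz u z) n r =
      (α ^ 2 / 2) * ((weight (α + 1) r)⁻¹ * mode u n r) := by
    have hz := ofReal_mem_disc hr'
    have i1 := rotAvg_integrand_continuous_right continuous_rotPos norm_rotPos
      (contDiffOn_dz (n := 0) (by simpa using hu.contDiffOn_weight_inv_dzbar)).continuousOn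
      (continuous_expMode n) hz
    have i2 := rotAvg_integrand_continuous_right continuous_rotPos norm_rotPos
      (contDiffOn_dzbar (n := 0) (by simpa using hu.contDiffOn_weight_inv_dz)).continuousOn
      (continuous_expMode n) hz
    rw [← mode_weight_inv_mul]
    simp only [mode, rotAvg]
    rw [← intervalIntegral.integral_add (i1.intervalIntegrable _ _) (i2.intervalIntegrable _ _),
      ← intervalIntegral.integral_const_mul]
    congr 1 with θ
    have := hu.2 _ (mul_mem_disc norm_rotPos hz θ)
    rw [opT, opL, opLstar] at this
    linear_combination (2 * expMode n θ) * this
  have hr0 : (r : ℂ) ≠ 0 := ofReal_ne_zero.2 hr.1.ne'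
  have h3 := (hasDerivAt_id r).ofReal_comp.mul (h1.add h2)
  refine h3.congr_deriv ?_
  simp only [Pi.add_apply, mode_weight_inv_mul, weight_ofReal, id] at *
  push_cast at *
  -- The remaining combination uses the angular identity for the two weighted derivatives (`a1`,
  -- `a2`), then for $u$ itself (`a3`).
  have hr1 : (r : ℂ) * (r : ℂ)⁻¹ = 1 := mul_inv_cancel₀ hr0
  linear_combination a1 - a2 + 2 * r * hL +
    (n * (((1 - r ^ 2 : ℝ) ^ α : ℝ) : ℂ)⁻¹ / r) * a3 - n * (((1 - r ^ 2 : ℝ) ^ α : ℝ) : ℂ)⁻¹ * (mode (dz u) (n - 1) r - mode (dzbar u) (n + 1) r) * hr1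

end IsTHarmonic

/-- A nontrivial bounded solution of `U' = k h`, `h' = q U` on `(0, 1)` with positive `k` and `q`
and with `h Ū → 0` at `0` has `h` bounded away from zero near `1`. -/
lemma exists_lower_bound_of_ode {U h : ℝ → ℂ} {k q : ℝ → ℝ} {B : ℝ}
    (hU : ∀ r ∈ Ioo (0 : ℝ) 1, HasDerivAt U (k r * h r) r)
    (hh : ∀ r ∈ Ioo (0 : ℝ) 1, HasDerivAt h (q r * U r) r)
    (hk : ∀ r ∈ Ioo (0 : ℝ) 1, 0 < k r) (hq : ∀ r ∈ Ioo (0 : ℝ) 1, 0 < q r)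
    (h0 : Tendsto (fun r => h r * conj (U r)) (𝓝[>] 0) (𝓝 0))
    (hB : ∀ r ∈ Ioo (0 : ℝ) 1, ‖U r‖ ≤ B) {r₀ : ℝ} (hr₀ : r₀ ∈ Ioo (0 : ℝ) 1) (hU₀ : U r₀ ≠ 0) :
    ∃ κ > 0, ∃ r₁ ∈ Ioo (0 : ℝ) 1, ∀ r ∈ Ico r₁ 1, κ ≤ ‖h r‖ := by
  -- The energy $G=\mathrm{Re}(h\bar U)$ satisfies $G'=q|U|^2+k|h|^2\ge0$, the cross terms being
  -- real because $k$ and $q$ are.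
  set G : ℝ → ℝ := fun r => (h r * conj (U r)).re with hG
  have hGd : ∀ r ∈ Ioo (0 : ℝ) 1, HasDerivAt G (q r * ‖U r‖ ^ 2 + k r * ‖h r‖ ^ 2) r := by
    intro r hr
    have h1 := (hh r hr).mul (hU r hr).star
    have h2 := reCLM.hasFDerivAt.comp_hasDerivAt r h1
    refine h2.congr_deriv ?_
    simp only [RCLike.star_def, map_mul, conj_ofReal, reCLM_apply]
    rw [mul_assoc, mul_conj, mul_left_comm, mul_conj, normSq_eq_norm_sq, normSq_eq_norm_sq]
    norm_cast
  have hmono : MonotoneOn G (Ioo 0 1) := by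
    refine monotoneOn_of_deriv_nonneg (convex_Ioo 0 1)
      (fun r hr => (hGd r hr).continuousAt.continuousWithinAt) ?_ ?_ <;> rw [interior_Ioo]
    · exact fun r hr => (hGd r hr).differentiableAt.differentiableWithinAt
    · intro r hr
      rw [(hGd r hr).deriv]
      have := hk r hr
      have := hq r hr
      positivity
  have hG0 : Tendsto G (𝓝[>] 0) (𝓝 0) := by
    have := (continuous_re.tendsto 0).comp h0
    rwa [zero_re] at this
  have hnn : ∀ r ∈ Ioo (0 : ℝ) 1, 0 ≤ G r := by
    intro r hr
    refine le_of_tendsto hG0 ?_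
    filter_upwards [Ioo_mem_nhdsGT hr.1] with s hs
    exact hmono ⟨hs.1, hs.2.trans hr.2⟩ hr hs.2.le
  -- At $r_0$ only $G\ge0$ is known. But $U(r_0)\ne0$ makes $G'(r_0)>0$, so $G$ is strictly positive
  -- slightly to the right.
  obtain ⟨r₁, hr₁, hpos⟩ : ∃ r₁ ∈ Ioo (0 : ℝ) 1, 0 < G r₁ := by
    have hd := hGd r₀ hr₀
    have hp : 0 < q r₀ * ‖U r₀‖ ^ 2 + k r₀ * ‖h r₀‖ ^ 2 := by
      have := hk r₀ hr₀
      have := mul_pos (hq r₀ hr₀) (pow_pos (norm_pos_iff.2 hU₀) 2)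
      positivity
    have hs := ((hasDerivAt_iff_tendsto_slope.1 hd).mono_left
      (nhdsWithin_mono (s := Ioi r₀) _ fun x hx => (mem_Ioi.1 hx).ne')).eventually (lt_mem_nhds hp)
    obtain ⟨r, hr, hr'⟩ := (hs.and (Ioo_mem_nhdsGT hr₀.2)).exists
    refine ⟨r, ⟨hr₀.1.trans hr'.1, hr'.2⟩, ?_⟩
    rw [slope_def_field] at hr
    have := (div_pos_iff_of_pos_right (sub_pos.2 hr'.1)).1 hr
    linarith [hnn r₀ hr₀]
  have hBpos : 0 < B := (norm_pos_iff.2 hU₀).trans_le (hB r₀ hr₀)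
  refine ⟨G r₁ / B, div_pos hpos hBpos, r₁, hr₁, fun r hr => ?_⟩
  have hr' : r ∈ Ioo (0 : ℝ) 1 := ⟨hr₁.1.trans_le hr.1, hr.2⟩
  rw [div_le_iff₀ hBpos]
  calc G r₁ ≤ G r := hmono hr₁ hr' hr.1
    _ ≤ ‖h r * conj (U r)‖ := re_le_norm _
    _ = ‖h r‖ * ‖U r‖ := by rw [norm_mul, RCLike.norm_conj]
    _ ≤ ‖h r‖ * B := by gcongr; exact hB r hr'

lemma one_sub_sq_pos {r : ℝ} (hr : r ∈ Ioo (0 : ℝ) 1) : 0 < 1 - r ^ 2 := by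
  nlinarith [hr.1, hr.2]

namespace IsTHarmonic

variable {α : ℝ} {u : ℂ → ℂ} (hu : IsTHarmonic α u)
include hu

lemma hasDerivAt_mode_flux (n : ℤ) {r : ℝ} (hr : r ∈ Ioo (0 : ℝ) 1) :
    HasDerivAt (mode u n) ((((1 - r ^ 2) ^ α / r : ℝ) : ℂ) * flux α u n r) r := by
  have hr' : r ∈ Ioo (-1 : ℝ) 1 := ⟨by linarith [hr.1], hr.2⟩
  refine (hasDerivAt_mode hu.contDiffOn_one n hr').congr_deriv ?_
  have hw := weight_ne_zero α (ofReal_mem_disc hr')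
  have hr0 : (r : ℂ) ≠ 0 := ofReal_ne_zero.2 hr.1.ne'
  rw [flux_eq, ofReal_div, ← weight_ofReal]
  field_simp

lemma norm_flux {n : ℤ} {r : ℝ} (hr : r ∈ Ioo (0 : ℝ) 1) :
    ‖mode (dz u) (n - 1) r + mode (dzbar u) (n + 1) r‖ = (1 - r ^ 2) ^ α / r * ‖flux α u n r‖ := by
  have hr' : r ∈ Ioo (-1 : ℝ) 1 := ⟨by linarith [hr.1], hr.2⟩
  rw [(hasDerivAt_mode hu.contDiffOn_one n hr').unique (hu.hasDerivAt_mode_flux n hr), norm_mul,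
    norm_real, Real.norm_of_nonneg]
  exact div_nonneg (Real.rpow_nonneg (one_sub_sq_pos hr).le _) hr.1.le

lemma tendsto_flux_zero (n : ℤ) : Tendsto (flux α u n) (𝓝[>] 0) (𝓝 0) := by
  have c1 := continuousOn_mode hu.contDiffOn_weight_inv_dz.continuousOn (n - 1)
  have c2 := continuousOn_mode hu.contDiffOn_weight_inv_dzbar.continuousOn (n + 1)
  have : ContinuousOn (flux α u n) (Ioo (-1) 1) :=
    continuous_ofReal.continuousOn.mul (c1.add c2)
  have h := (this.continuousAt (Ioo_mem_nhds (by norm_num) (by norm_num : (0 : ℝ) < 1))).tendsto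
  have e : flux α u n 0 = 0 := by simp [flux]
  rw [e] at h
  exact h.mono_left nhdsWithin_le_nhds

/-- The flux is bounded below by the energy argument, and $U'=(1-r^2)^\alpha h/r$ with $1/r>1$ turns
this into a bound on $U'$. -/
lemma exists_lower_bound_mode (hα : α ≠ 0) {n : ℤ} {B : ℝ}
    (hB : ∀ r ∈ Ioo (0 : ℝ) 1, ‖mode u n r‖ ≤ B) {r₀ : ℝ} (hr₀ : r₀ ∈ Ioo (0 : ℝ) 1)
    (h₀ : mode u n r₀ ≠ 0) :
    ∃ κ > 0, ∃ r₁ ∈ Ioo (0 : ℝ) 1, ∀ r ∈ Ico r₁ 1,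
      κ * (1 - r ^ 2) ^ α ≤ ‖mode (dz u) (n - 1) r + mode (dzbar u) (n + 1) r‖ := by
  obtain ⟨κ, hκ, r₁, hr₁, H⟩ := exists_lower_bound_of_ode
    (fun r hr => hu.hasDerivAt_mode_flux n hr) (fun r hr => hu.hasDerivAt_flux n hr)
    (fun r hr => div_pos (Real.rpow_pos_of_pos (one_sub_sq_pos hr) _) hr.1)
    (fun r hr => by
      have h1 := Real.rpow_pos_of_pos (one_sub_sq_pos hr) (α + 1)
      have h2 := Real.rpow_pos_of_pos (one_sub_sq_pos hr) α
      have h3 := hr.1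
      positivity) (by
      have hz : ContinuousAt (mode u n) 0 :=
        (continuousOn_mode hu.contDiffOn_one.continuousOn n).continuousAt
          (Ioo_mem_nhds (by norm_num) (by norm_num : (0 : ℝ) < 1))
      have := (hu.tendsto_flux_zero n).mul ((continuous_conj.continuousAt.comp hz).tendsto.mono_left
        nhdsWithin_le_nhds)
      simpa using this) hB hr₀ h₀
  refine ⟨κ, hκ, r₁, hr₁, fun r hr => ?_⟩
  have hr' : r ∈ Ioo (0 : ℝ) 1 := ⟨hr₁.1.trans_le hr.1, hr.2⟩
  rw [hu.norm_flux hr']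
  have h2 := Real.rpow_pos_of_pos (one_sub_sq_pos hr') α
  calc κ * (1 - r ^ 2) ^ α ≤ ‖flux α u n r‖ * ((1 - r ^ 2) ^ α / r) := by
        gcongr
        · exact H r hr
        · exact (le_div_iff₀ hr'.1).2 (by nlinarith [hr'.2])
    _ = _ := mul_comm _ _

/-- For $n=0$ the equation reads $h'=\alpha^2r(1-r^2)^{-\alpha-1}U$. With $|U|\le B$ and $h(0^+)=0$,
the right-hand side is the integral of the resulting bound on $|h'|$ over $(0,r)$. -/
lemma norm_flux_zero_le {B : ℝ} (hB : ∀ r ∈ Ioo (0 : ℝ) 1, ‖mode u 0 r‖ ≤ B)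
    {r : ℝ} (hr : r ∈ Ioo (0 : ℝ) 1) :
    ‖flux α u 0 r‖ ≤ B * (α / 2) * (((1 - r ^ 2) ^ α)⁻¹ - 1) := by
  set Φ : ℝ → ℝ := fun r => B * (α / 2) * ((1 - r ^ 2) ^ (-α) - 1) with hΦ
  have hΦd : ∀ s ∈ Ico (0 : ℝ) 1, HasDerivAt Φ (s * α ^ 2 * ((1 - s ^ 2) ^ (α + 1))⁻¹ * B) s := by
    intro s hs
    have hs' : 0 < 1 - s ^ 2 := by nlinarith [hs.1, hs.2]
    have h1 : HasDerivAt (fun s : ℝ => 1 - s ^ 2) (-(2 * s)) s := by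
      simpa using ((hasDerivAt_id s).pow 2).const_sub 1
    have h2 := ((h1.rpow_const (p := -α) (Or.inl hs'.ne')).sub_const 1).const_mul (B * (α / 2))
    refine h2.congr_deriv ?_
    rw [← Real.rpow_neg hs'.le, neg_add, ← sub_eq_add_neg]
    ring
  -- The flux equation is available only on the open interval, so the comparison starts at
  -- $\varepsilon>0$ and then $\varepsilon\to0$.
  have key : ∀ ε ∈ Ioo 0 r, ‖flux α u 0 r‖ ≤ Φ r - Φ ε + ‖flux α u 0 ε‖ := by
    intro ε hε
    have hsub : ∀ x ∈ Icc ε r, x ∈ Ioo (0 : ℝ) 1 := fun x hx =>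
      ⟨hε.1.trans_le hx.1, hx.2.trans_lt hr.2⟩
    refine image_norm_le_of_norm_deriv_right_le_deriv_boundary' (a := ε) (b := r)
      (f := flux α u 0) (B := fun x => Φ x - Φ ε + ‖flux α u 0 ε‖)
      (f' := fun x => _) (B' := fun x => x * α ^ 2 * ((1 - x ^ 2) ^ (α + 1))⁻¹ * B)
      (fun x hx => (hu.hasDerivAt_flux 0 (hsub x hx)).continuousAt.continuousWithinAt)
      (fun x hx => (hu.hasDerivAt_flux 0 (hsub x (Ico_subset_Icc_self hx))).hasDerivWithinAt)
      (by simp) (fun x hx => ?_) (fun x hx => ?_) (fun x hx => ?_) ⟨hε.2.le, le_rfl⟩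
    · have hx' := hsub x hx
      exact (((hΦd x ⟨hx'.1.le, hx'.2⟩).sub_const _).add_const
        _).continuousAt.continuousWithinAt
    · have hx' := hsub x (Ico_subset_Icc_self hx)
      exact (((hΦd x ⟨hx'.1.le, hx'.2⟩).sub_const _).add_const _).hasDerivWithinAt
    · have hx' := hsub x (Ico_subset_Icc_self hx)
      have h1 := Real.rpow_pos_of_pos (one_sub_sq_pos hx') (α + 1)
      have h2 : 0 ≤ x * α ^ 2 * ((1 - x ^ 2) ^ (α + 1))⁻¹ := by
        have := hx'.1
        positivity
      rw [norm_mul, norm_real, Int.cast_zero, zero_pow two_ne_zero, mul_zero, zero_div, add_zero,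
        Real.norm_of_nonneg h2]
      exact mul_le_mul_of_nonneg_left (hB x hx') h2
  have hlim : Tendsto (fun ε => Φ r - Φ ε + ‖flux α u 0 ε‖) (𝓝[>] 0) (𝓝 (Φ r - Φ 0 + ‖(0 : ℂ)‖)) := by
    refine (tendsto_const_nhds.sub ?_).add (hu.tendsto_flux_zero 0).norm
    exact (hΦd 0 (by norm_num)).continuousAt.tendsto.mono_left nhdsWithin_le_nhds
  have hfin := ge_of_tendsto hlim (by
    filter_upwards [Ioo_mem_nhdsGT hr.1] with ε hε using key ε hε)
  have e0 : Φ 0 = 0 := by simp [hΦ]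
  rw [e0, norm_zero, sub_zero, add_zero] at hfin
  rwa [← Real.rpow_neg (one_sub_sq_pos hr).le]

end IsTHarmonic

/-! ### Bounded modes force vanishing when $\alpha<0$ -/

/-- All Fourier coefficients vanish, so they are summable and the series converges pointwise to the
continuous function $g$. -/
lemma eq_zero_of_integral_expMode {g : ℝ → ℂ} (hg : Continuous g)
    (hp : Function.Periodic g (2 * Real.pi))
    (h : ∀ n : ℤ, ∫ θ in (0 : ℝ)..(2 * Real.pi), expMode n θ * g θ = 0) (θ : ℝ) : g θ = 0 := by
  have : Fact (0 < 2 * Real.pi) := ⟨by positivity⟩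
  let F : C(AddCircle (2 * Real.pi), ℂ) :=
    ⟨hp.lift, continuous_coinduced_dom.2 hg⟩
  have hF : ∀ n, fourierCoeff F n = 0 := by
    intro n
    rw [fourierCoeff_eq_intervalIntegral F n 0, zero_add]
    convert smul_zero _ using 2
    rw [← h n]
    congr 1 with x
    rw [fourier_coe_apply, smul_eq_mul]
    congr 1
    rw [expMode]
    congr 1
    push_cast
    field_simp
  have hs := has_pointwise_sum_fourier_series_of_summable (f := F)
    (by rw [funext hF]; exact summable_zero) θ
  simp only [hF, zero_smul] at hs
  exact (hasSum_zero.unique hs).symm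

lemma periodic_rotPos : Function.Periodic rotPos (2 * Real.pi) := fun θ => by
  rw [rotPos, rotPos, ofReal_add, add_mul, exp_add]
  simp

lemma exists_eq_mul_rotPos (z : ℂ) : ∃ θ ∈ Ioc (-Real.pi) Real.pi, z = ‖z‖ * rotPos θ :=
  ⟨arg z, ⟨neg_pi_lt_arg z, arg_le_pi z⟩, (norm_mul_exp_arg_mul_I z).symm⟩

lemma slice_eq (v : ℂ → ℂ) (r θ : ℝ) : slice v r θ = v (r * rotPos θ) := rfl

lemma ofReal_mul_rotPos_mem_disc {r : ℝ} (hr : r ∈ Ioo (-1 : ℝ) 1) (θ : ℝ) : r * rotPos θ ∈ disc :=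
  mul_mem_disc norm_rotPos (ofReal_mem_disc hr) θ

lemma continuous_slice {v : ℂ → ℂ} (hv : ContinuousOn v disc) {r : ℝ} (hr : r ∈ Ioo (-1 : ℝ) 1) :
    Continuous (slice v r) :=
  hv.comp_continuous (continuous_const.mul continuous_rotPos) (ofReal_mul_rotPos_mem_disc hr)

lemma periodic_slice (v : ℂ → ℂ) (r : ℝ) : Function.Periodic (slice v r) (2 * Real.pi) :=
  fun θ => by rw [slice_eq, slice_eq, periodic_rotPos]

/-- Fourier uniqueness on each circle covers every point except the origin, which is reached by
continuity. -/
lemma eqOn_zero_of_mode_eq_zero {v : ℂ → ℂ} (hv : ContinuousOn v disc)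
    (h : ∀ r ∈ Ioo (0 : ℝ) 1, ∀ n, mode v n r = 0) : ∀ z ∈ disc, v z = 0 := by
  have h1 : ∀ z ∈ disc, z ≠ 0 → v z = 0 := by
    intro z hz hz0
    obtain ⟨θ, -, hθ⟩ := exists_eq_mul_rotPos z
    have hr : ‖z‖ ∈ Ioo (0 : ℝ) 1 := ⟨norm_pos_iff.2 hz0, mem_disc.1 hz⟩
    have hr' : ‖z‖ ∈ Ioo (-1 : ℝ) 1 := ⟨by linarith [hr.1], hr.2⟩
    rw [hθ]
    exact eq_zero_of_integral_expMode (continuous_slice hv hr') (periodic_slice v _) (h _ hr) θ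
  intro z hz
  by_cases hz0 : z = 0
  · subst hz0
    have hc := (hv.continuousAt (isOpen_disc.mem_nhds hz)).tendsto.mono_left
      (nhdsWithin_le_nhds (s := {0}ᶜ))
    refine tendsto_nhds_unique hc (tendsto_const_nhds.congr' ?_)
    filter_upwards [nhdsWithin_le_nhds (isOpen_disc.mem_nhds hz), self_mem_nhdsWithin] with w hw hw0
    exact (h1 w hw hw0).symm
  · exact h1 z hz hz0

lemma enorm_mode_le (v : ℂ → ℂ) (n : ℤ) {r : ℝ} (hr : r ∈ Ioo (0 : ℝ) 1) :
    ‖mode v n r‖ₑ ≤ ENNReal.ofReal (2 * Real.pi) * hardyNorm 1 v := by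
  have h1 : eLpNorm (slice v r) 1 arcMeasure ≤ hardyNorm 1 v := by
    rw [hardyNorm, if_neg ENNReal.one_ne_top]
    exact le_iSup₂ (f := fun r (_ : r ∈ Ioo (0 : ℝ) 1) => eLpNorm (slice v r) 1 arcMeasure) r hr
  refine le_trans ?_ (mul_le_mul_right h1 _)
  rw [mode, rotAvg, intervalIntegral.integral_of_le (by positivity)]
  refine (enorm_integral_le_lintegral_enorm _).trans_eq ?_
  rw [eLpNorm_one_eq_lintegral_enorm, arcMeasure, lintegral_smul_measure, smul_eq_mul, ← mul_assoc,
    ← ENNReal.ofReal_mul (by positivity), mul_inv_cancel₀ (by positivity), ENNReal.ofReal_one,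
    one_mul]
  congr 1 with θ
  rw [enorm_mul, ← ofReal_norm, norm_expMode, ENNReal.ofReal_one, one_mul]
  rfl

lemma tendsto_one_sub_sq_rpow_atTop {α : ℝ} (hα : α < 0) :
    Tendsto (fun r : ℝ => (1 - r ^ 2) ^ α) (𝓝[<] 1) atTop := by
  refine (tendsto_rpow_neg_nhdsGT_zero hα).comp (tendsto_nhdsWithin_iff.2 ⟨?_, ?_⟩)
  · have : ContinuousAt (fun r : ℝ => 1 - r ^ 2) 1 := by fun_prop
    simpa [ContinuousAt] using this.tendsto.mono_left nhdsWithin_le_nhds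
  · filter_upwards [Ioo_mem_nhdsLT (zero_lt_one' ℝ)] with r hr using one_sub_sq_pos hr

lemma norm_mode_le_of_memHardyG {v : ℂ → ℂ} (hv : MemHardyG 1 v) :
    ∃ C : ℝ, ∀ n, ∀ r ∈ Ioo (0 : ℝ) 1, ‖mode v n r‖ ≤ C := by
  refine ⟨(ENNReal.ofReal (2 * Real.pi) * hardyNorm 1 v).toReal, fun n r hr => ?_⟩
  rw [← toReal_enorm]
  exact ENNReal.toReal_mono (ENNReal.mul_ne_top ENNReal.ofReal_ne_top hv.2.2.ne)
    (enorm_mode_le v n hr)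

namespace IsTHarmonic

variable {α : ℝ} {u : ℂ → ℂ} (hu : IsTHarmonic α u)
include hu

/-- A bounded `T_α`-harmonic function, `α < 0`, vanishes as soon as one of the modes of index
`n - 1` of `∂_z u` or of index `n + 1` of `∂_{z̄} u` is bounded, for every `n`. -/
lemma eq_zero_of_bounded_modes (hα : α < 0) {B : ℝ} (hB : ∀ z ∈ disc, ‖u z‖ ≤ B)
    (h : ∀ n : ℤ, ∃ C : ℝ, ∀ r ∈ Ioo (0 : ℝ) 1,
      ‖mode (dz u) (n - 1) r‖ ≤ C ∨ ‖mode (dzbar u) (n + 1) r‖ ≤ C) :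
    ∀ z ∈ disc, u z = 0 := by
  refine eqOn_zero_of_mode_eq_zero hu.contDiffOn_one.continuousOn fun r₀ hr₀ n => ?_
  by_contra h₀
  have hmB : ∀ r ∈ Ioo (0 : ℝ) 1, ‖mode u n r‖ ≤ B * (2 * Real.pi) := fun r hr =>
    norm_mode_le fun θ => hB _ (ofReal_mul_rotPos_mem_disc ⟨by linarith [hr.1], hr.2⟩ θ)
  obtain ⟨κ, hκ, r₁, hr₁, H⟩ := hu.exists_lower_bound_mode hα.ne hmB hr₀ h₀
  obtain ⟨C, hC⟩ := h n
  set M := B * (2 * Real.pi)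
  -- The threshold is chosen so that $\kappa(1-r^2)^\alpha$ exceeds twice the bounded mode plus the
  -- bound $|n|M/r_1$ for the difference of the two modes.
  have hev : ∀ᶠ r in 𝓝[<] (1 : ℝ), (2 * C + |(n : ℝ)| * M / r₁) / κ < (1 - r ^ 2) ^ α :=
    (tendsto_one_sub_sq_rpow_atTop hα).eventually_gt_atTop _
  obtain ⟨r, hr, hr'⟩ := (hev.and (Ioo_mem_nhdsLT hr₁.2)).exists
  have hr0 : 0 < r := hr₁.1.trans hr'.1
  have hrI : r ∈ Ioo (0 : ℝ) 1 := ⟨hr0, hr'.2⟩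
  have h1 := H r ⟨hr'.1.le, hr'.2⟩
  rw [div_lt_iff₀ hκ, mul_comm] at hr
  have h2 := mode_angular hu.contDiffOn_one n (r := r) ⟨by linarith, hr'.2⟩
  have h3 : ‖mode (dz u) (n - 1) r - mode (dzbar u) (n + 1) r‖ ≤ |(n : ℝ)| * M / r₁ := by
    have : ‖mode (dz u) (n - 1) r - mode (dzbar u) (n + 1) r‖ = |(n : ℝ)| * ‖mode u n r‖ / r := by
      rw [eq_div_iff hr0.ne', mul_comm]
      have := congrArg norm h2
      rwa [norm_mul, norm_mul, norm_real, Real.norm_of_nonneg hr0.le, norm_intCast] at this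
    rw [this]
    have hM := hmB r hrI
    have hM0 : 0 ≤ M := (norm_nonneg _).trans hM
    have := hr₁.1
    gcongr
    exact hr'.1.le
  rcases hC r hrI with hC | hC
  -- With $a$, $b$ the two modes, $a+b=2a-(a-b)$: bounding one mode and the difference bounds the
  -- sum.
  · have : mode (dz u) (n - 1) r + mode (dzbar u) (n + 1) r =
        2 * mode (dz u) (n - 1) r - (mode (dz u) (n - 1) r - mode (dzbar u) (n + 1) r) := by ring
    rw [this] at h1
    have h4 := norm_sub_le (2 * mode (dz u) (n - 1) r)
      (mode (dz u) (n - 1) r - mode (dzbar u) (n + 1) r)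
    rw [norm_mul, norm_ofNat] at h4
    linarith
  · have : mode (dz u) (n - 1) r + mode (dzbar u) (n + 1) r =
        2 * mode (dzbar u) (n + 1) r + (mode (dz u) (n - 1) r - mode (dzbar u) (n + 1) r) := by ring
    rw [this] at h1
    have h4 := norm_add_le (2 * mode (dzbar u) (n + 1) r)
      (mode (dz u) (n - 1) r - mode (dzbar u) (n + 1) r)
    rw [norm_mul, norm_ofNat] at h4
    linarith

lemma eq_zero_of_memHardyG_dz (hα : α < 0) {B : ℝ} (hB : ∀ z ∈ disc, ‖u z‖ ≤ B)
    (h : MemHardyG 1 (dz u)) : ∀ z ∈ disc, u z = 0 := by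
  obtain ⟨C, hC⟩ := norm_mode_le_of_memHardyG h
  exact hu.eq_zero_of_bounded_modes hα hB fun n => ⟨C, fun r hr => .inl (hC _ r hr)⟩

lemma eq_zero_of_memHardyG_dzbar (hα : α < 0) {B : ℝ} (hB : ∀ z ∈ disc, ‖u z‖ ≤ B)
    (h : MemHardyG 1 (dzbar u)) : ∀ z ∈ disc, u z = 0 := by
  obtain ⟨C, hC⟩ := norm_mode_le_of_memHardyG h
  exact hu.eq_zero_of_bounded_modes hα hB fun n => ⟨C, fun r hr => .inr (hC _ r hr)⟩

end IsTHarmonic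

lemma memHardyG_of_eqOn_zero {v : ℂ → ℂ} (h : ∀ z ∈ disc, v z = 0) (p : ℝ≥0∞) : MemHardyG p v := by
  have hs : ∀ r ∈ Ioo (0 : ℝ) 1, slice v r = fun _ => 0 := fun r hr => funext fun θ =>
    h _ (ofReal_mul_rotPos_mem_disc ⟨by linarith [hr.1], hr.2⟩ θ)
  refine ⟨?_, fun r hr => by rw [hs r hr]; exact aemeasurable_const, ?_⟩
  · refine (aemeasurable_const (b := (0 : ℂ))).congr ?_
    exact (ae_restrict_of_forall_mem isOpen_disc.measurableSet fun z hz => (h z hz).symm)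
  · rw [hardyNorm]
    split_ifs
    · refine lt_of_le_of_lt (iSup₂_le fun z hz => ?_) ENNReal.zero_lt_top
      simp [h z hz]
    · refine lt_of_le_of_lt (iSup₂_le fun r hr => ?_) ENNReal.zero_lt_top
      rw [hs r hr]
      simp

/-! ### Size of the kernel and of its derivatives -/

lemma poissonConst_pos {α : ℝ} (hα : -1 < α) : 0 < poissonConst (α / 2) (α / 2) := by
  rw [poissonConst]
  have h1 := Real.Gamma_pos_of_pos (s := α / 2 + 1) (by linarith)
  have h2 := Real.Gamma_pos_of_pos (s := α / 2 + α / 2 + 1) (by linarith)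
  positivity

lemma norm_kernelFactor (s : ℝ) {z : ℂ} (hz : z ∈ disc) :
    ‖kernelFactor s z‖ = ‖1 - z‖ ^ (-(2 * s)) := by
  have h : ‖1 - conj z‖ = ‖1 - z‖ := by
    rw [← RCLike.norm_conj (1 - z), map_sub, map_one]
  have h0 : 0 < ‖1 - z‖ := norm_pos_iff.2 (one_sub_ne_zero hz)
  rw [kernelFactor, norm_mul, ← ofReal_neg, norm_cpow_real, norm_cpow_real, h, ← Real.rpow_add h0]
  congr 1
  ring

lemma norm_weight (e : ℝ) {z : ℂ} (hz : z ∈ disc) : ‖weight e z‖ = (1 - ‖z‖ ^ 2) ^ e := by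
  rw [weight, norm_real, Real.norm_of_nonneg (Real.rpow_nonneg (one_sub_norm_sq_pos hz).le _)]

lemma one_sub_norm_le (z : ℂ) : 1 - ‖z‖ ≤ ‖1 - z‖ := by
  simpa using norm_sub_norm_le 1 z

lemma one_sub_norm_sq_rpow_le (e : ℝ) {r : ℝ} (hr : r ∈ Ico (0 : ℝ) 1) :
    (1 - r ^ 2) ^ e ≤ 2 ^ |e| * (1 - r) ^ e := by
  have h1 : 0 < 1 - r := by linarith [hr.2]
  have h2 : 1 ≤ 1 + r := by linarith [hr.1]
  rw [show 1 - r ^ 2 = (1 + r) * (1 - r) by ring, Real.mul_rpow (by linarith) h1.le]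
  gcongr
  calc (1 + r) ^ e ≤ (1 + r) ^ |e| := Real.rpow_le_rpow_of_exponent_le h2 (le_abs_self e)
    _ ≤ 2 ^ |e| := Real.rpow_le_rpow (by linarith) (by linarith [hr.2]) (abs_nonneg e)

/-- Put $A=|1-re^{is}|$. Then $1-r\le A$ and $|1-e^{is}|\le A+(1-r)\le2A$. Moreover
$|1-e^{is}|=2|\sin(s/2)|\ge\frac2\pi|s|$, so $|s|\le\pi A\le4A$. The constant is $1+4$. -/
lemma add_abs_le_norm_one_sub {r s : ℝ} (hr : r ∈ Ico (0 : ℝ) 1) (hs : |s| ≤ Real.pi) :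
    1 - r + |s| ≤ 5 * ‖1 - r * rotPos s‖ := by
  have hn : ‖(r : ℂ) * rotPos s‖ = r := by
    rw [norm_mul, norm_rotPos, norm_real, Real.norm_of_nonneg hr.1, mul_one]
  have h1 : 1 - r ≤ ‖1 - r * rotPos s‖ := by
    simpa only [hn] using one_sub_norm_le (r * rotPos s)
  have h2 : ‖1 - rotPos s‖ ≤ 2 * ‖1 - r * rotPos s‖ := by
    calc ‖1 - rotPos s‖ = ‖(1 - r * rotPos s) - ((1 - r : ℝ) : ℂ) * rotPos s‖ := by
          congr 1; push_cast; ring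
      _ ≤ ‖1 - r * rotPos s‖ + ‖((1 - r : ℝ) : ℂ) * rotPos s‖ := norm_sub_le _ _
      _ = ‖1 - r * rotPos s‖ + (1 - r) := by
          rw [norm_mul, norm_rotPos, norm_real, Real.norm_of_nonneg (by linarith [hr.2]), mul_one]
      _ ≤ _ := by linarith
  have h3 : 2 / Real.pi * |s| ≤ ‖1 - rotPos s‖ := by
    have e : ‖1 - rotPos s‖ = 2 * |Real.sin (s / 2)| := by
      rw [norm_sub_rev, rotPos, mul_comm, norm_exp_I_mul_ofReal_sub_one, Real.norm_eq_abs, abs_mul,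
        abs_of_pos (zero_lt_two' ℝ)]
    have h5 := Real.mul_abs_le_abs_sin (x := s / 2) (by rw [abs_div]; norm_num; linarith)
    rw [e]
    rw [abs_div, abs_of_pos (zero_lt_two' ℝ)] at h5
    linarith
  have h4 : |s| ≤ 4 * ‖1 - r * rotPos s‖ := by
    have hpi : Real.pi ≤ 4 := Real.pi_le_four
    have h6 : |s| = Real.pi / 2 * (2 / Real.pi * |s|) := by field_simp
    have h7 : 0 ≤ 2 / Real.pi * |s| := by positivity
    rw [h6]
    nlinarith
  linarith

/-- The profile `(1-r)^β (1-r+|s|)^{-(α+2)}` bounding the Poisson kernel and its derivatives. -/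
def profile (α β r s : ℝ) : ℝ := (1 - r) ^ β * (1 - r + |s|) ^ (-(α + 2))

/-- A derivative costs one power of $1-r$: it lowers the weight exponent from $\alpha+1$ to
$\alpha$, while the remaining factor stays bounded because $1-|z|^2\le2|1-z|$. -/
lemma exists_kernel_bound {α : ℝ} (hα : -1 < α) :
    ∃ C : ℝ, 0 ≤ C ∧ ∀ r ∈ Ico (0 : ℝ) 1, ∀ s, |s| ≤ Real.pi →
      ‖poissonKernel (α / 2) (α / 2) (r * rotPos s)‖ ≤ C * profile α (α + 1) r s ∧
      ‖dz (poissonKernel (α / 2) (α / 2)) (r * rotPos s)‖ ≤ C * profile α α r s ∧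
      ‖dzbar (poissonKernel (α / 2) (α / 2)) (r * rotPos s)‖ ≤ C * profile α α r s := by
  set c := poissonConst (α / 2) (α / 2)
  have hc : 0 < c := poissonConst_pos hα
  refine ⟨c * (2 ^ (|α| + 1)) * 5 ^ (α + 2) * (2 * α + 3), ?_, fun r hr s hs => ?_⟩
  · have : 0 < 2 * α + 3 := by linarith
    positivity
  set z := (r : ℂ) * rotPos s with hz
  have hzd : z ∈ disc := ofReal_mul_rotPos_mem_disc ⟨by linarith [hr.1], hr.2⟩ s
  have hn : ‖z‖ = r := by
    rw [hz, norm_mul, norm_rotPos, norm_real, Real.norm_of_nonneg hr.1, mul_one]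
  have hδ : 0 < 1 - r := by linarith [hr.2]
  have hA : 0 < ‖1 - z‖ := norm_pos_iff.2 (one_sub_ne_zero hzd)
  have hδA : 1 - r ≤ ‖1 - z‖ := by simpa [hn] using one_sub_norm_le z
  have hP : ‖kernelFactor (α / 2 + 1) z‖ ≤ 5 ^ (α + 2) * (1 - r + |s|) ^ (-(α + 2)) := by
    have h5 := add_abs_le_norm_one_sub hr hs
    have hb : 0 < 1 - r + |s| := by positivity
    rw [norm_kernelFactor _ hzd, show -(2 * (α / 2 + 1)) = -(α + 2) by ring]
    calc ‖1 - z‖ ^ (-(α + 2)) ≤ ((1 - r + |s|) / 5) ^ (-(α + 2)) :=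
          Real.rpow_le_rpow_of_nonpos (by positivity) (by linarith) (by linarith)
      _ = 5 ^ (α + 2) * (1 - r + |s|) ^ (-(α + 2)) := by
          rw [Real.div_rpow hb.le (by norm_num), Real.rpow_neg (by norm_num : (0 : ℝ) ≤ 5), div_inv_eq_mul,
            mul_comm]
  have h2α : (2 : ℝ) ^ |α| ≤ 2 ^ (|α| + 1) :=
    Real.rpow_le_rpow_of_exponent_le (by norm_num) (by linarith)
  have hW : ‖weight α z‖ ≤ 2 ^ (|α| + 1) * (1 - r) ^ α := by
    rw [norm_weight _ hzd, hn]
    refine (one_sub_norm_sq_rpow_le α hr).trans ?_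
    gcongr
  have hW1 : ‖weight (α + 1) z‖ ≤ 2 ^ (|α| + 1) * (1 - r) ^ (α + 1) := by
    rw [norm_weight _ hzd, hn]
    refine (one_sub_norm_sq_rpow_le (α + 1) hr).trans ?_
    gcongr
    · norm_num
    · exact (abs_add_le _ _).trans (by simp)
  have hP0 : 0 ≤ 5 ^ (α + 2) * (1 - r + |s|) ^ (-(α + 2)) := (norm_nonneg _).trans hP
  have hx : ‖1 - z * conj z‖ ≤ 2 * ‖1 - z‖ := by
    rw [← ofReal_one_sub_norm_sq, norm_real, Real.norm_of_nonneg (one_sub_norm_sq_pos hzd).le, hn]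
    nlinarith [hr.1]
  have hA' : ‖1 - conj z‖ = ‖1 - z‖ := by
    rw [← RCLike.norm_conj (1 - z), map_sub, map_one]
  have ha1 : ‖(α + 1 : ℂ)‖ = α + 1 := by
    rw [show (α + 1 : ℂ) = ((α + 1 : ℝ) : ℂ) by push_cast; rfl, norm_real,
      Real.norm_of_nonneg (by linarith)]
  have ha2 : ‖(α / 2 + 1 : ℂ)‖ = α / 2 + 1 := by
    rw [show (α / 2 + 1 : ℂ) = ((α / 2 + 1 : ℝ) : ℂ) by push_cast; rfl, norm_real,
      Real.norm_of_nonneg (by linarith)]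
  -- The bound is $(\alpha+1)+2(\frac\alpha2+1)=2\alpha+3$. It also exceeds $1$, so the same
  -- constant serves for the kernel itself.
  have bracket : ∀ y w : ℂ, ‖y‖ ≤ 1 → ‖1 - w‖ = ‖1 - z‖ →
      ‖-(α + 1 : ℂ) * y + (α / 2 + 1) * (1 - z * conj z) * (1 - w)⁻¹‖ ≤ 2 * α + 3 := by
    intro y w hy hw
    refine (norm_add_le _ _).trans ?_
    rw [norm_mul, norm_neg, ha1, norm_mul, norm_mul, ha2, norm_inv, hw, mul_assoc]
    have h1 : ‖1 - z * conj z‖ * ‖1 - z‖⁻¹ ≤ 2 := by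
      rwa [← div_eq_mul_inv, div_le_iff₀ hA]
    have h2 : (α + 1) * ‖y‖ ≤ α + 1 := by nlinarith
    have h3 : (α / 2 + 1) * (‖1 - z * conj z‖ * ‖1 - z‖⁻¹) ≤ (α / 2 + 1) * 2 :=
      mul_le_mul_of_nonneg_left h1 (by linarith)
    linarith
  have hcn : ‖(c : ℂ)‖ = c := by rw [norm_real, Real.norm_of_nonneg hc.le]
  have hz1 : ‖z‖ ≤ 1 := by rw [hn]; exact hr.2.le
  have main : ∀ b : ℂ, ‖b‖ ≤ 2 * α + 3 →
      ‖c * weight α z * kernelFactor (α / 2 + 1) z * b‖ ≤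
        c * (2 ^ (|α| + 1)) * 5 ^ (α + 2) * (2 * α + 3) * profile α α r s := by
    intro b hb
    rw [norm_mul, norm_mul, norm_mul, hcn]
    calc c * ‖weight α z‖ * ‖kernelFactor (α / 2 + 1) z‖ * ‖b‖
        ≤ c * (2 ^ (|α| + 1) * (1 - r) ^ α) * (5 ^ (α + 2) * (1 - r + |s|) ^ (-(α + 2))) *
          (2 * α + 3) := by gcongr
      _ = _ := by rw [profile]; ring
  refine ⟨?_, ?_, ?_⟩
  · rw [poissonKernel_eq, norm_mul, norm_mul, hcn]
    calc c * (‖weight (α + 1) z‖ * ‖kernelFactor (α / 2 + 1) z‖)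
        ≤ c * ((2 ^ (|α| + 1) * (1 - r) ^ (α + 1)) *
          (5 ^ (α + 2) * (1 - r + |s|) ^ (-(α + 2)))) * 1 := by rw [mul_one]; gcongr
      _ ≤ c * ((2 ^ (|α| + 1) * (1 - r) ^ (α + 1)) *
          (5 ^ (α + 2) * (1 - r + |s|) ^ (-(α + 2)))) * (2 * α + 3) := by
          gcongr
          linarith
      _ = _ := by rw [profile]; ring
  · rw [(hasWirt_poissonKernel α hzd).dz_eq]
    exact main _ (bracket _ _ (by rwa [RCLike.norm_conj]) rfl)
  · rw [(hasWirt_poissonKernel α hzd).dzbar_eq]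
    exact main _ (bracket _ _ hz1 hA')

lemma integral_add_abs_rpow {δ e : ℝ} (hδ : 0 < δ) (he : e ≠ -1) :
    ∫ s in (-Real.pi)..Real.pi, (δ + |s|) ^ e =
      2 * (((δ + Real.pi) ^ (e + 1) - δ ^ (e + 1)) / (e + 1)) := by
  have hc : Continuous fun s : ℝ => (δ + |s|) ^ e :=
    Continuous.rpow_const (by fun_prop) fun s => Or.inl (by positivity)
  have h1 : ∫ s in (0 : ℝ)..Real.pi, (δ + |s|) ^ e =
      ((δ + Real.pi) ^ (e + 1) - δ ^ (e + 1)) / (e + 1) := by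
    have : ∫ s in (0 : ℝ)..Real.pi, (δ + |s|) ^ e = ∫ s in (0 : ℝ)..Real.pi, (δ + s) ^ e := by
      refine intervalIntegral.integral_congr fun s hs => ?_
      rw [uIcc_of_le Real.pi_pos.le] at hs
      simp only [abs_of_nonneg hs.1]
    rw [this, intervalIntegral.integral_comp_add_left (fun x => x ^ e), integral_rpow, add_zero]
    refine Or.inr ⟨he, ?_⟩
    rw [uIcc_of_le (by linarith [Real.pi_pos])]
    intro h
    linarith [h.1]
  have h2 : ∫ s in (-Real.pi)..0, (δ + |s|) ^ e = ∫ s in (0 : ℝ)..Real.pi, (δ + |s|) ^ e := by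
    have := intervalIntegral.integral_comp_neg (a := 0) (b := Real.pi) (fun s => (δ + |s|) ^ e)
    simp only [abs_neg, neg_zero] at this
    exact this.symm
  rw [← intervalIntegral.integral_add_adjacent_intervals (hc.intervalIntegrable _ 0)
    (hc.intervalIntegrable 0 _), h2, h1]
  ring

lemma continuous_profile (α β : ℝ) {r : ℝ} (hr : r ∈ Ico (0 : ℝ) 1) :
    Continuous (profile α β r) := by
  have : 0 < 1 - r := by linarith [hr.2]
  exact continuous_const.mul (Continuous.rpow_const (by fun_prop) fun s => Or.inl (by positivity))

lemma profile_nonneg (α β : ℝ) {r : ℝ} (hr : r ∈ Ico (0 : ℝ) 1) (s : ℝ) :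
    0 ≤ profile α β r s := by
  have : 0 < 1 - r := by linarith [hr.2]
  rw [profile]
  positivity

/-- The powers of $1-r$ cancel exactly; this gives boundedness of Poisson integrals of bounded data.
-/
lemma integral_profile_le {α : ℝ} (hα : -1 < α) {r : ℝ} (hr : r ∈ Ico (0 : ℝ) 1) :
    ∫ s in (-Real.pi)..Real.pi, profile α (α + 1) r s ≤ 2 / (α + 1) := by
  have hδ : 0 < 1 - r := by linarith [hr.2]
  simp only [profile]
  rw [intervalIntegral.integral_const_mul, integral_add_abs_rpow hδ (by linarith),
    show -(α + 2) + 1 = -(α + 1) by ring, div_neg, ← neg_div, neg_sub]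
  have h1 : 0 ≤ (1 - r + Real.pi) ^ (-(α + 1)) := by positivity
  have h2 : (1 - r) ^ (α + 1) * (1 - r) ^ (-(α + 1)) = 1 := by
    rw [← Real.rpow_add hδ]; simp
  have h3 : 0 ≤ (1 - r) ^ (α + 1) := by positivity
  have hα1 : 0 < α + 1 := by linarith
  rw [show ∀ a b c d : ℝ, a * (2 * ((b - c) / d)) = 2 * (a * b - a * c) / d by intros; ring, h2]
  gcongr
  nlinarith [mul_nonneg h3 h1]

/-- Bounding $|s|$ by $1-r+|s|$ leaves $(1-r)^\alpha\int(1-r+|s|)^{-\alpha-1}ds$. For $\alpha>0$ the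
integral is $O((1-r)^{-\alpha})$, for $\alpha<0$ it is $O(1)$. For $\alpha=0$ a logarithm would
appear. -/
lemma exists_integral_profile_mul_abs_le {α : ℝ} (hα0 : α ≠ 0) :
    ∃ C : ℝ, 0 ≤ C ∧ ∀ r ∈ Ico (0 : ℝ) 1,
      ∫ s in (-Real.pi)..Real.pi, profile α α r s * |s| ≤ C * (1 - r) ^ (min α 0) := by
  have key : ∀ r ∈ Ico (0 : ℝ) 1, ∫ s in (-Real.pi)..Real.pi, profile α α r s * |s| ≤
      (1 - r) ^ α * (2 * (((1 - r + Real.pi) ^ (-α) - (1 - r) ^ (-α)) / (-α))) := by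
    intro r hr
    have hδ : 0 < 1 - r := by linarith [hr.2]
    have e := integral_add_abs_rpow hδ (e := -(α + 1)) (fun h => hα0 (by linarith))
    rw [show -(α + 1) + 1 = -α by ring] at e
    rw [← e, ← intervalIntegral.integral_const_mul]
    refine intervalIntegral.integral_mono_on (by linarith [Real.pi_pos])
      (((continuous_profile α α hr).mul continuous_abs).intervalIntegrable _ _)
      (Continuous.intervalIntegrable ?_ _ _) fun s _ => ?_
    · exact continuous_const.mul
        (Continuous.rpow_const (by fun_prop) fun s => Or.inl (by positivity))
    · have hb : 0 < 1 - r + |s| := by positivity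
      rw [profile, mul_assoc, show -(α + 1) = -(α + 2) + 1 by ring, Real.rpow_add_one hb.ne']
      gcongr
      linarith
  rcases lt_or_gt_of_ne hα0 with h | h
  · refine ⟨2 * (1 + Real.pi) ^ (-α) / (-α), ?_, fun r hr => (key r hr).trans ?_⟩
    · have : 0 < -α := by linarith
      positivity
    have hδ : 0 < 1 - r := by linarith [hr.2]
    have hδ1 : 1 - r ≤ 1 := by linarith [hr.1]
    have hn : 0 < -α := by linarith
    rw [min_eq_left h.le, mul_comm ((1 - r) ^ α), ← mul_div_assoc]
    gcongr
    have : 0 ≤ (1 - r) ^ (-α) := by positivity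
    calc (1 - r + Real.pi) ^ (-α) - (1 - r) ^ (-α) ≤ (1 - r + Real.pi) ^ (-α) := by linarith
      _ ≤ (1 + Real.pi) ^ (-α) := by gcongr
  · refine ⟨2 / α, by positivity, fun r hr => (key r hr).trans ?_⟩
    have hδ : 0 < 1 - r := by linarith [hr.2]
    have h1 : 0 ≤ (1 - r + Real.pi) ^ (-α) := by positivity
    have h2 : (1 - r) ^ α * (1 - r) ^ (-α) = 1 := by rw [← Real.rpow_add hδ]; simp
    have h3 : 0 ≤ (1 - r) ^ α := by positivity
    rw [min_eq_right h.le, Real.rpow_zero, mul_one, div_neg, ← neg_div, neg_sub,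
      show ∀ a b c d : ℝ, a * (2 * ((b - c) / d)) = 2 * (a * b - a * c) / d by intros; ring, h2]
    gcongr
    nlinarith [mul_nonneg h3 h1]

/-! ### Minkowski's inequality and translations of periodic functions -/

/-- A form of **Minkowski's integral inequality** with a uniform bound on the sections. -/
lemma eLpNorm_lintegral_le {X Y : Type*} [MeasurableSpace X] [MeasurableSpace Y] {μ : Measure X}
    {ν : Measure Y} [SFinite μ] [SFinite ν] {p N : ℝ≥0∞} (hp : 1 ≤ p) {H : X → Y → ℝ≥0∞}
    (hH : Measurable (Function.uncurry H)) (hN : ∀ y, eLpNorm (fun x => H x y) p μ ≤ N) :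
    eLpNorm (fun x => ∫⁻ y, H x y ∂ν) p μ ≤ N * ν univ := by
  have hp0 : p ≠ 0 := (zero_lt_one.trans_le hp).ne'
  by_cases hpt : p = ∞
  · subst hpt
    rw [eLpNorm_exponent_top, eLpNormEssSup]
    refine essSup_le_of_ae_le _ ?_
    have h1 : ∀ᵐ y ∂ν, ∀ᵐ x ∂μ, H x y ≤ N := by
      refine ae_of_all _ fun y => ?_
      filter_upwards [ae_le_eLpNormEssSup (f := fun x => H x y) (μ := μ)] with x hx
      have := hN y
      rw [eLpNorm_exponent_top] at this
      exact hx.trans this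
    have h2 := (Measure.ae_ae_comm (μ := μ) (ν := ν) (p := fun x y => H x y ≤ N)
      (measurableSet_le hH measurable_const)).2 h1
    filter_upwards [h2] with x hx
    rw [enorm_eq_self]
    calc ∫⁻ y, H x y ∂ν ≤ ∫⁻ _, N ∂ν := lintegral_mono_ae hx
      _ = N * ν univ := lintegral_const N
  · set q := p.toReal with hq
    have hq1 : 1 ≤ q := by
      rw [hq, ← ENNReal.toReal_one]
      exact (ENNReal.toReal_le_toReal ENNReal.one_ne_top hpt).2 hp
    have hq0 : 0 < q := by linarith
    have hN' : ∀ y, ∫⁻ x, H x y ^ q ∂μ ≤ N ^ q := by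
      intro y
      have := hN y
      rw [eLpNorm_eq_lintegral_rpow_enorm_toReal hp0 hpt, ← hq, one_div,
        ENNReal.rpow_inv_le_iff hq0] at this
      simpa using this
    -- Jensen's inequality with respect to the measure `ν`. Tonelli's theorem and the uniform bound
    -- on sections then suffice.
    have hJ : ∀ x, (∫⁻ y, H x y ∂ν) ^ q ≤ (∫⁻ y, H x y ^ q ∂ν) * ν univ ^ (q - 1) := by
      intro x
      have hm : Measurable (H x) := hH.comp measurable_prodMk_left
      have := eLpNorm'_le_eLpNorm'_mul_rpow_measure_univ (μ := ν) one_pos hq1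
        hm.aestronglyMeasurable
      simp only [eLpNorm', enorm_eq_self, ENNReal.rpow_one, div_one] at this
      have h2 := ENNReal.rpow_le_rpow this hq0.le
      rw [ENNReal.mul_rpow_of_nonneg _ _ hq0.le, ← ENNReal.rpow_mul, ← ENNReal.rpow_mul,
        one_div_mul_cancel hq0.ne', ENNReal.rpow_one] at h2
      convert h2 using 3
      field_simp
    rw [eLpNorm_eq_lintegral_rpow_enorm_toReal hp0 hpt, ← hq, one_div, ENNReal.rpow_inv_le_iff hq0]
    simp only [enorm_eq_self]
    calc ∫⁻ x, (∫⁻ y, H x y ∂ν) ^ q ∂μ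
        ≤ ∫⁻ x, (∫⁻ y, H x y ^ q ∂ν) * ν univ ^ (q - 1) ∂μ := lintegral_mono hJ
      _ = (∫⁻ x, ∫⁻ y, H x y ^ q ∂ν ∂μ) * ν univ ^ (q - 1) :=
          lintegral_mul_const _ (Measurable.lintegral_prod_right (hH.pow_const q))
      _ = (∫⁻ y, ∫⁻ x, H x y ^ q ∂μ ∂ν) * ν univ ^ (q - 1) := by
          rw [lintegral_lintegral_swap (hH.pow_const q).aemeasurable]
      _ ≤ (∫⁻ _, N ^ q ∂ν) * ν univ ^ (q - 1) := by gcongr with y; exact hN' y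
      _ = N ^ q * (ν univ ^ (q - 1) * ν univ ^ (1 : ℝ)) := by
          rw [lintegral_const, ENNReal.rpow_one]; ring
      _ = (N * ν univ) ^ q := by
          rw [← ENNReal.rpow_add_of_nonneg _ _ (by linarith) zero_le_one, sub_add_cancel,
            ENNReal.mul_rpow_of_nonneg _ _ hq0.le]

instance : IsProbabilityMeasure arcMeasure := ⟨by
  rw [arcMeasure, Measure.smul_apply, Measure.restrict_apply_univ, Real.volume_Ioc, sub_zero,
    smul_eq_mul, ← ENNReal.ofReal_mul (by positivity), inv_mul_cancel₀ (by positivity),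
    ENNReal.ofReal_one]⟩

lemma lintegral_Ioc_periodic {G : ℝ → ℝ≥0∞} (hG : Function.Periodic G (2 * Real.pi)) (a b : ℝ) :
    ∫⁻ θ in Ioc a (a + 2 * Real.pi), G θ = ∫⁻ θ in Ioc b (b + 2 * Real.pi), G θ := by
  have hT : 0 < 2 * Real.pi := by positivity
  have : VAddInvariantMeasure (AddSubgroup.zmultiples (2 * Real.pi)) ℝ volume :=
    ⟨fun c s _ => measure_preimage_add _ _ _⟩
  exact (isAddFundamentalDomain_Ioc hT a).setLIntegral_eq (isAddFundamentalDomain_Ioc hT b) G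
    hG.map_vadd_zmultiples

lemma lintegral_arcMeasure_translate {G : ℝ → ℝ≥0∞} (hG : Function.Periodic G (2 * Real.pi))
    (x : ℝ) : ∫⁻ θ, G (θ + x) ∂arcMeasure = ∫⁻ θ, G θ ∂arcMeasure := by
  rw [arcMeasure, lintegral_smul_measure, lintegral_smul_measure]
  congr 1
  have h1 : ∫⁻ θ in Ioc 0 (2 * Real.pi), G (θ + x) = ∫⁻ θ in Ioc x (x + 2 * Real.pi), G θ := by
    have := (measurePreserving_add_right volume x).setLIntegral_comp_preimage_emb
      (measurableEmbedding_addRight x) G (Ioc x (x + 2 * Real.pi))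
    rw [← this, preimage_add_const_Ioc]
    simp
  rw [h1, lintegral_Ioc_periodic hG x 0, zero_add]

lemma eLpNorm_arcMeasure_translate {g : ℝ → ℂ} (hg : Function.Periodic g (2 * Real.pi))
    (hm : Measurable g) (p : ℝ≥0∞) (x : ℝ) :
    eLpNorm (fun θ => g (θ + x)) p arcMeasure = eLpNorm g p arcMeasure := by
  by_cases hp0 : p = 0
  · simp [hp0]
  by_cases hpt : p = ∞
  · subst hpt
    -- The essential supremum depends only on the measures of the superlevel sets, which are
    -- translation invariant.
    have hae : ∀ a : ℝ≥0∞, arcMeasure {θ | a < ‖g (θ + x)‖ₑ} = arcMeasure {θ | a < ‖g θ‖ₑ} := by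
      intro a
      have hs : MeasurableSet {θ | a < ‖g θ‖ₑ} := measurableSet_lt measurable_const hm.enorm
      have h := lintegral_arcMeasure_translate (G := {θ | a < ‖g θ‖ₑ}.indicator 1)
        (fun θ => by simp [indicator, hg θ]) x
      have e : ∀ θ, ({θ | a < ‖g θ‖ₑ}.indicator 1 (θ + x) : ℝ≥0∞) =
        {θ | a < ‖g (θ + x)‖ₑ}.indicator 1 θ := fun θ => rfl
      simp only [e] at h
      have hs' : MeasurableSet {θ | a < ‖g (θ + x)‖ₑ} := hs.preimage (measurable_add_const x)
      rwa [lintegral_indicator_one hs, lintegral_indicator_one hs'] at h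
    rw [eLpNorm_exponent_top, eLpNorm_exponent_top, eLpNormEssSup, eLpNormEssSup,
      essSup_eq_sInf, essSup_eq_sInf]
    simp only [hae]
  · rw [eLpNorm_eq_lintegral_rpow_enorm_toReal hp0 hpt, eLpNorm_eq_lintegral_rpow_enorm_toReal hp0 hpt,
      lintegral_arcMeasure_translate (G := fun θ => ‖g θ‖ₑ ^ p.toReal) fun θ => by
        simp only [hg θ]]

/-! ### Absolutely continuous functions on the circle -/

lemma comp_lipschitz_absolutelyContinuous {f : ℝ → ℂ} {a b : ℝ} {g : ℂ → ℝ} (hg : LipschitzWith 1 g)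
    (hf : AbsolutelyContinuousOnInterval f a b) :
    AbsolutelyContinuousOnInterval (fun x => g (f x)) a b := by
  refine squeeze_zero (fun t => Finset.sum_nonneg fun i _ => dist_nonneg) (fun t => ?_) hf
  refine Finset.sum_le_sum fun i _ => ?_
  simpa using hg.dist_le_mul (f (t.2 i).1) (f (t.2 i).2)

/-- Reduces to the real-valued fundamental theorem for real and imaginary parts, which inherit
absolute continuity because `re` and `im` are 1-Lipschitz. -/
lemma integral_deriv_eq_sub_of_absolutelyContinuous {f : ℝ → ℂ} {a b : ℝ}
    (hf : AbsolutelyContinuousOnInterval f a b) :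
    IntervalIntegrable (deriv f) volume a b ∧ ∫ x in a..b, deriv f x = f b - f a := by
  have h1 := comp_lipschitz_absolutelyContinuous (g := fun z => z.re)
    (RCLike.lipschitzWith_re (K := ℂ)) hf
  have h2 := comp_lipschitz_absolutelyContinuous (g := fun z => z.im)
    (RCLike.lipschitzWith_im (K := ℂ)) hf
  have hd : ∀ᵐ x, x ∈ uIcc a b → deriv f x =
      ((deriv (fun x => (f x).re) x : ℝ) : ℂ) + ((deriv (fun x => (f x).im) x : ℝ) : ℂ) * I := by
    filter_upwards [h1.ae_differentiableAt, h2.ae_differentiableAt] with x hx1 hx2 hx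
    have h := (hx1 hx).hasDerivAt.ofReal_comp.add ((hx2 hx).hasDerivAt.ofReal_comp.mul_const I)
    have e : (fun y => ((f y).re : ℂ)) + (fun y => ((f y).im : ℂ) * I) = f := by
      ext y; exact re_add_im (f y)
    rw [e] at h
    exact h.deriv
  have i1 := h1.intervalIntegrable_deriv
  have i2 := h2.intervalIntegrable_deriv
  have i1' : IntervalIntegrable (fun x => ((deriv (fun x => (f x).re) x : ℝ) : ℂ)) volume a b :=
    ⟨i1.1.ofReal, i1.2.ofReal⟩
  have i2' : IntervalIntegrable (fun x => ((deriv (fun x => (f x).im) x : ℝ) : ℂ)) volume a b :=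
    ⟨i2.1.ofReal, i2.2.ofReal⟩
  have hd' : ∀ᵐ x, x ∈ uIoc a b → deriv f x =
      ((deriv (fun x => (f x).re) x : ℝ) : ℂ) + ((deriv (fun x => (f x).im) x : ℝ) : ℂ) * I := by
    filter_upwards [hd] with x hx hx' using hx (uIoc_subset_uIcc hx')
  refine ⟨?_, ?_⟩
  · refine (i1'.add (i2'.mul_const I)).congr_ae ?_
    rw [EventuallyEq, ae_restrict_iff' measurableSet_uIoc]
    filter_upwards [hd'] with x hx hx' using (hx hx').symm
  · rw [intervalIntegral.integral_congr_ae hd', intervalIntegral.integral_add i1' (i2'.mul_const I),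
      intervalIntegral.integral_mul_const, intervalIntegral.integral_ofReal,
      intervalIntegral.integral_ofReal, h1.integral_deriv_eq_sub, h2.integral_deriv_eq_sub]
    apply Complex.ext <;> simp

section AbsContCircle

variable {f : Circle → ℂ}

lemma periodic_comp_circleExp (f : Circle → ℂ) :
    Function.Periodic (fun θ : ℝ => f (Circle.exp θ)) (2 * Real.pi) := fun θ => by
  simp only [Circle.periodic_exp θ]

lemma periodic_circleDeriv (f : Circle → ℂ) : Function.Periodic (circleDeriv f) (2 * Real.pi) := by
  intro θ
  have : (fun t : ℝ => f (Circle.exp t)) = fun t : ℝ => f (Circle.exp (t + 2 * Real.pi)) :=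
    funext fun t => (periodic_comp_circleExp f t).symm
  conv_rhs => rw [circleDeriv, this]
  exact (deriv_comp_add_const (fun t : ℝ => f (Circle.exp t)) (2 * Real.pi) θ).symm

lemma measurable_circleDeriv (f : Circle → ℂ) : Measurable (circleDeriv f) := measurable_deriv _

lemma AbsContCircle.intervalIntegrable (hf : AbsContCircle f) (a b : ℝ) :
    IntervalIntegrable (circleDeriv f) volume a b :=
  (periodic_circleDeriv f).intervalIntegrable₀ (by positivity)
    (integral_deriv_eq_sub_of_absolutelyContinuous hf).1 a b

/-- Absolute continuity is given on one period only. The difference `F` of the function and its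
primitive is constant there, and it is periodic because $\dot f$ has integral $f(1)-f(1)=0$ over a
period. -/
lemma AbsContCircle.integral_circleDeriv (hf : AbsContCircle f) (a b : ℝ) :
    ∫ x in a..b, circleDeriv f x = f (Circle.exp b) - f (Circle.exp a) := by
  set F : ℝ → ℂ := fun x => f (Circle.exp x) - ∫ t in (0 : ℝ)..x, circleDeriv f t with hF
  have h2π : ∫ t in (0 : ℝ)..(2 * Real.pi), circleDeriv f t = 0 := by
    have := (integral_deriv_eq_sub_of_absolutelyContinuous hf).2
    rw [circleDeriv, this]
    simp
  have hper : Function.Periodic F (2 * Real.pi) := by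
    intro x
    simp only [hF]
    rw [Circle.periodic_exp x, (periodic_circleDeriv f).intervalIntegral_add_eq_add 0 x
      (fun a b => hf.intervalIntegrable a b), zero_add, h2π, add_zero]
  have h0 : ∀ x ∈ Icc (0 : ℝ) (2 * Real.pi), F x = f (Circle.exp 0) := by
    intro x hx
    have hm : AbsolutelyContinuousOnInterval (fun θ : ℝ => f (Circle.exp θ)) 0 x :=
      AbsolutelyContinuousOnInterval.mono hf (by
        rw [uIcc_of_le hx.1, uIcc_of_le (by positivity)]; exact Icc_subset_Icc_right hx.2)
    have := (integral_deriv_eq_sub_of_absolutelyContinuous hm).2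
    simp only [hF, circleDeriv]
    rw [this]
    ring
  have hall : ∀ x, F x = f (Circle.exp 0) := by
    intro x
    obtain ⟨y, hy, hxy⟩ := hper.exists_mem_Ico₀ (by positivity) x
    rw [hxy]
    exact h0 y (Ico_subset_Icc_self hy)
  have ha := hall a
  have hb := hall b
  simp only [hF] at ha hb
  rw [← intervalIntegral.integral_interval_sub_left (hf.intervalIntegrable 0 b)
    (hf.intervalIntegrable 0 a)]
  linear_combination ha - hb

lemma AbsContCircle.continuous (hf : AbsContCircle f) :
    Continuous fun θ : ℝ => f (Circle.exp θ) := by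
  have h : (fun θ : ℝ => f (Circle.exp θ)) =
      fun θ => (∫ x in (0 : ℝ)..θ, circleDeriv f x) + f (Circle.exp 0) := by
    ext θ
    rw [hf.integral_circleDeriv]
    ring
  rw [h]
  exact (intervalIntegral.continuous_primitive (fun a b => hf.intervalIntegrable a b) 0).add
    continuous_const

lemma AbsContCircle.exists_bound (hf : AbsContCircle f) :
    ∃ B : ℝ, 0 ≤ B ∧ ∀ θ : ℝ, ‖f (Circle.exp θ)‖ ≤ B := by
  obtain ⟨B, hB⟩ := (isCompact_Icc (a := (0 : ℝ)) (b := 2 * Real.pi)).exists_bound_of_continuousOn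
    hf.continuous.continuousOn
  have hB' : ∀ θ : ℝ, ‖f (Circle.exp θ)‖ ≤ B := by
    intro θ
    obtain ⟨y, hy, hxy⟩ := (periodic_comp_circleExp f).exists_mem_Ico₀ (by positivity) θ
    rw [show f (Circle.exp θ) = f (Circle.exp y) from hxy]
    exact hB y (Ico_subset_Icc_self hy)
  exact ⟨B, (norm_nonneg _).trans (hB' 0), hB'⟩

lemma AbsContCircle.enorm_sub_le (hf : AbsContCircle f) (t s : ℝ) :
    ‖f (Circle.exp (t + s)) - f (Circle.exp t)‖ₑ ≤ ∫⁻ x in uIoc 0 s, ‖circleDeriv f (t + x)‖ₑ := by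
  have h := intervalIntegral.integral_comp_add_left (a := 0) (b := s) (circleDeriv f) t
  rw [add_zero] at h
  rw [← hf.integral_circleDeriv, ← h, ← ofReal_norm, intervalIntegral.norm_integral_eq_norm_integral_uIoc, ofReal_norm]
  exact enorm_integral_le_lintegral_enorm _

/-- The increment is at most the integral of $|\dot f(t+x)|$ over $x$ between $0$ and $s$.
Minkowski's inequality and translation invariance give the $L^p$ bound. -/
lemma AbsContCircle.eLpNorm_sub_le (hf : AbsContCircle f) {p : ℝ≥0∞} (hp : 1 ≤ p) (s : ℝ) :
    eLpNorm (fun t => f (Circle.exp (t + s)) - f (Circle.exp t)) p arcMeasure ≤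
      eLpNorm (circleDeriv f) p arcMeasure * ENNReal.ofReal |s| := by
  have h := eLpNorm_lintegral_le (μ := arcMeasure) (ν := volume.restrict (uIoc 0 s)) hp
    (H := fun t x => ‖circleDeriv f (t + x)‖ₑ) (N := eLpNorm (circleDeriv f) p arcMeasure)
    ((measurable_circleDeriv f).enorm.comp measurable_add) fun x => by
      rw [eLpNorm_enorm, eLpNorm_arcMeasure_translate (periodic_circleDeriv f)
        (measurable_circleDeriv f)]
  rw [Measure.restrict_apply_univ] at h
  have hv : volume (uIoc 0 s) = ENNReal.ofReal |s| := by
    rw [uIoc, Real.volume_Ioc, max_sub_min_eq_abs]; simp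
  rw [hv] at h
  refine le_trans (eLpNorm_mono_enorm fun t => ?_) h
  rw [enorm_eq_self]
  exact hf.enorm_sub_le t s

end AbsContCircle

/-! ### Poisson integrals as convolutions; subtraction of the boundary value -/

lemma rotNeg_eq (θ : ℝ) : rotNeg θ = rotPos (-θ) := by
  rw [rotNeg, rotPos]; push_cast; rw [neg_mul]

lemma rotPos_add (s t : ℝ) : rotPos (s + t) = rotPos s * rotPos t := by
  rw [rotPos, rotPos, rotPos, ← exp_add]; push_cast; rw [add_mul]

lemma rotPos_zero : rotPos 0 = 1 := by simp [rotPos]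

lemma rotNeg_add (s t : ℝ) : rotNeg (s + t) = rotNeg s * rotNeg t := by
  rw [rotNeg_eq, rotNeg_eq, rotNeg_eq, ← rotPos_add]; congr 1; ring

lemma periodic_rotNeg : Function.Periodic rotNeg (2 * Real.pi) := fun θ => by
  rw [rotNeg_eq, rotNeg_eq, neg_add]
  have := periodic_rotPos (-θ + -(2 * Real.pi))
  rw [← this]; congr 1; ring

/-- The period is recentred at $t$ so that $|s|\le\pi$, the range in which the kernel bounds hold.
-/
lemma rotAvg_rotNeg_eq {Q : ℂ → ℂ} {g : ℝ → ℂ} (hg : Function.Periodic g (2 * Real.pi)) (r t : ℝ) :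
    rotAvg rotNeg Q g (r * rotPos t) =
      ∫ s in (-Real.pi)..Real.pi, g (t + s) * Q (r * rotPos (-s)) := by
  have hp : Function.Periodic (fun θ => g θ * Q (r * rotPos t * rotNeg θ)) (2 * Real.pi) :=
    fun θ => by simp only [hg θ, periodic_rotNeg θ]
  have h1 := hp.intervalIntegral_add_eq 0 (t + -Real.pi)
  rw [zero_add, show t + -Real.pi + 2 * Real.pi = t + Real.pi by ring] at h1
  rw [rotAvg, h1, ← intervalIntegral.integral_comp_add_left
    (fun θ => g θ * Q (r * rotPos t * rotNeg θ))]
  congr 1 with s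
  rw [rotNeg_eq, mul_assoc, ← rotPos_add]
  congr 4
  ring

lemma norm_rotAvg_le {Q : ℂ → ℂ} {g : ℝ → ℂ} {B : ℝ} {k : ℝ → ℝ} {r : ℝ}
    (hg : Function.Periodic g (2 * Real.pi)) (hB : ∀ θ, ‖g θ‖ ≤ B) (hk : Continuous k)
    (hQ : ∀ s, |s| ≤ Real.pi → ‖Q (r * rotPos (-s))‖ ≤ k s) (t : ℝ) :
    ‖rotAvg rotNeg Q g (r * rotPos t)‖ ≤ B * ∫ s in (-Real.pi)..Real.pi, k s := by
  rw [rotAvg_rotNeg_eq hg, ← intervalIntegral.integral_const_mul]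
  refine intervalIntegral.norm_integral_le_of_norm_le (by linarith [Real.pi_pos])
    (ae_of_all _ fun s hs => ?_) ((hk.intervalIntegrable _ _).const_mul B)
  rw [norm_mul]
  have hs' : |s| ≤ Real.pi := abs_le.2 ⟨hs.1.le, hs.2⟩
  exact mul_le_mul (hB _) (hQ s hs') (norm_nonneg _) ((norm_nonneg _).trans (hB 0))

/-- The density `(2π)⁻¹ ε`. -/
def unitDensity (ε : ℝ → ℂ) (θ : ℝ) : ℂ := (1 / (2 * Real.pi) : ℂ) * ε θ

lemma norm_unitDensity_le {ε : ℝ → ℂ} (hε : ∀ θ, ‖ε θ‖ = 1) (θ : ℝ) : ‖unitDensity ε θ‖ ≤ 1 := by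
  rw [unitDensity, norm_mul, hε, mul_one]
  have : (1 / (2 * Real.pi) : ℂ) = ((1 / (2 * Real.pi) : ℝ) : ℂ) := by push_cast; rfl
  rw [this, norm_real, Real.norm_of_nonneg (by positivity), div_le_one (by positivity)]
  linarith [Real.pi_gt_three]

section Estimate

variable {f : Circle → ℂ} {ε : ℝ → ℂ} {Q : ℂ → ℂ} {r : ℝ} {k : ℝ → ℝ}

lemma enorm_rotAvg_sub_le (hf : Continuous fun θ : ℝ => f (Circle.exp θ)) (hε : Continuous ε)
    (hεp : Function.Periodic ε (2 * Real.pi)) (hε1 : ∀ θ, ‖ε θ‖ ≤ 1) (hQ : ContinuousOn Q disc)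
    (hr : r ∈ Ico (0 : ℝ) 1) (hk : ∀ s, |s| ≤ Real.pi → ‖Q (r * rotPos (-s))‖ ≤ k s) (t : ℝ) :
    ‖rotAvg rotNeg Q (fun θ => f (Circle.exp θ) * ε θ) (r * rotPos t) -
        f (Circle.exp t) * rotAvg rotNeg Q ε (r * rotPos t)‖ₑ ≤
      ∫⁻ s in Ioc (-Real.pi) Real.pi,
        ENNReal.ofReal (k s) * ‖f (Circle.exp (t + s)) - f (Circle.exp t)‖ₑ := by
  have hr' : r ∈ Ioo (-1 : ℝ) 1 := ⟨by linarith [hr.1], hr.2⟩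
  have hQc : Continuous fun s : ℝ => Q (r * rotPos (-s)) :=
    (continuous_slice hQ hr').comp continuous_neg
  have hF : Continuous fun s : ℝ => f (Circle.exp (t + s)) := hf.comp (continuous_const_add t)
  have hE : Continuous fun s : ℝ => ε (t + s) := hε.comp (continuous_const_add t)
  have hp : Function.Periodic (fun θ : ℝ => f (Circle.exp θ) * ε θ) (2 * Real.pi) :=
    (periodic_comp_circleExp f).mul hεp
  rw [rotAvg_rotNeg_eq hp, rotAvg_rotNeg_eq hεp, ← intervalIntegral.integral_const_mul,
    ← intervalIntegral.integral_sub, intervalIntegral.integral_of_le (by linarith [Real.pi_pos])]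
  · refine (enorm_integral_le_lintegral_enorm _).trans ?_
    refine setLIntegral_mono_ae' measurableSet_Ioc (ae_of_all _ fun s hs => ?_)
    have hs' : |s| ≤ Real.pi := abs_le.2 ⟨hs.1.le, hs.2⟩
    rw [show ∀ a b c d : ℂ, a * c * d - b * (c * d) = d * (c * (a - b)) by intros; ring, enorm_mul,
      enorm_mul]
    gcongr
    · rw [← ofReal_norm]; exact ENNReal.ofReal_le_ofReal (hk s hs')
    · refine mul_le_of_le_one_left' ?_
      rw [← ofReal_norm, ← ENNReal.ofReal_one]
      exact ENNReal.ofReal_le_ofReal (hε1 _)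
  · exact ((hF.mul hE).mul hQc).intervalIntegrable _ _
  · exact (continuous_const.mul (hE.mul hQc)).intervalIntegrable _ _

lemma eLpNorm_rotAvg_sub_le (hf : AbsContCircle f) {p : ℝ≥0∞} (hp : 1 ≤ p) (hε : Continuous ε)
    (hεp : Function.Periodic ε (2 * Real.pi)) (hε1 : ∀ θ, ‖ε θ‖ ≤ 1) (hQ : ContinuousOn Q disc)
    (hr : r ∈ Ico (0 : ℝ) 1) (hkc : Continuous k) (hk0 : ∀ s, 0 ≤ k s)
    (hk : ∀ s, |s| ≤ Real.pi → ‖Q (r * rotPos (-s))‖ ≤ k s) :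
    eLpNorm (fun t => rotAvg rotNeg Q (fun θ => f (Circle.exp θ) * ε θ) (r * rotPos t) -
        f (Circle.exp t) * rotAvg rotNeg Q ε (r * rotPos t)) p arcMeasure ≤
      eLpNorm (circleDeriv f) p arcMeasure *
        ENNReal.ofReal (∫ s in (-Real.pi)..Real.pi, k s * |s|) := by
  set μ := (volume : Measure ℝ).restrict (Ioc (-Real.pi) Real.pi)
  set w : ℝ → ℝ≥0∞ := fun s => ENNReal.ofReal (k s) * ENNReal.ofReal |s| with hw
  have hwm : Measurable w :=
    (ENNReal.measurable_ofReal.comp hkc.measurable).mul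
      (ENNReal.measurable_ofReal.comp measurable_norm)
  -- Difference quotients have $L^p$ norm in $t$ at most $\|\dot f\|_p$ uniformly in $s$. The
  -- compensating factor $|s|$ goes into the measure $k(s)|s|\,ds$, whose mass is the first moment.
  -- At $s=0$ the convention $0/0=0$ keeps the bound true.
  set H : ℝ → ℝ → ℝ≥0∞ := fun t s =>
    ‖f (Circle.exp (t + s)) - f (Circle.exp t)‖ₑ / ENNReal.ofReal |s| with hH
  have hHm : Measurable (Function.uncurry H) := by
    have h1 : Continuous fun x : ℝ × ℝ => f (Circle.exp (x.1 + x.2)) - f (Circle.exp x.1) :=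
      (hf.continuous.comp continuous_add).sub (hf.continuous.comp continuous_fst)
    exact h1.measurable.enorm.div
      (ENNReal.measurable_ofReal.comp (measurable_norm.comp measurable_snd))
  have hsec : ∀ s, eLpNorm (fun t => H t s) p arcMeasure ≤ eLpNorm (circleDeriv f) p arcMeasure := by
    intro s
    by_cases hs : s = 0
    · have : (fun t => H t s) = fun _ => 0 := by ext t; simp [hH, hs]
      rw [this]
      simp
    have hs1 : ENNReal.ofReal |s| ≠ 0 := by simpa using hs
    have hs2 : ENNReal.ofReal |s| ≠ ∞ := ENNReal.ofReal_ne_top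
    have h1 := hf.eLpNorm_sub_le hp s
    have hreal : (fun t => H t s) = fun t =>
        ‖((|s|⁻¹ : ℝ) : ℂ) * (f (Circle.exp (t + s)) - f (Circle.exp t))‖ₑ := by
      ext t
      simp only [hH]
      rw [enorm_mul, ENNReal.div_eq_inv_mul, ← ofReal_norm ((|s|⁻¹ : ℝ) : ℂ), norm_real,
        Real.norm_of_nonneg (by positivity), ENNReal.ofReal_inv_of_pos (abs_pos.2 hs)]
    rw [hreal, eLpNorm_enorm]
    refine (eLpNorm_const_smul_le (c := ((|s|⁻¹ : ℝ) : ℂ))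
      (f := fun t => f (Circle.exp (t + s)) - f (Circle.exp t))).trans ?_
    rw [← ofReal_norm, norm_real, Real.norm_of_nonneg (by positivity),
      ENNReal.ofReal_inv_of_pos (abs_pos.2 hs), ← ENNReal.div_eq_inv_mul]
    exact ENNReal.div_le_of_le_mul h1
  have key := eLpNorm_lintegral_le (μ := arcMeasure) (ν := μ.withDensity w) hp hHm hsec
  have hmass : μ.withDensity w univ = ENNReal.ofReal (∫ s in (-Real.pi)..Real.pi, k s * |s|) := by
    rw [withDensity_apply _ MeasurableSet.univ, Measure.restrict_univ,
      intervalIntegral.integral_of_le (by linarith [Real.pi_pos]),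
      ofReal_integral_eq_lintegral_ofReal]
    · congr 1 with s
      rw [hw, ENNReal.ofReal_mul (hk0 s)]
    · exact (hkc.mul continuous_abs).integrableOn_Ioc
    · exact ae_of_all _ fun s => mul_nonneg (hk0 s) (abs_nonneg s)
  rw [hmass] at key
  refine le_trans (eLpNorm_mono_enorm fun t => ?_) key
  rw [enorm_eq_self]
  refine (enorm_rotAvg_sub_le hf.continuous hε hεp hε1 hQ hr hk t).trans_eq ?_
  rw [lintegral_withDensity_eq_lintegral_mul _ hwm (hHm.of_uncurry_left (x := t))]
  congr 1 with s
  simp only [Pi.mul_apply, hw, hH]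
  by_cases hs : s = 0
  · simp [hs]
  have hs1 : ENNReal.ofReal |s| ≠ 0 := by simpa using hs
  rw [mul_assoc, ENNReal.mul_div_cancel hs1 ENNReal.ofReal_ne_top]

end Estimate

lemma contDiffOn_one_poissonKernel (α : ℝ) :
    ContDiffOn ℝ 1 (poissonKernel (α / 2) (α / 2)) disc := by
  exact_mod_cast contDiffOn_poissonKernel α 1

lemma continuousOn_dz_poissonKernel (α : ℝ) :
    ContinuousOn (dz (poissonKernel (α / 2) (α / 2))) disc :=
  (contDiffOn_dz (contDiffOn_poissonKernel α (0 + 1))).continuousOn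

lemma continuousOn_dzbar_poissonKernel (α : ℝ) :
    ContinuousOn (dzbar (poissonKernel (α / 2) (α / 2))) disc :=
  (contDiffOn_dzbar (contDiffOn_poissonKernel α (0 + 1))).continuousOn

/-- The factor $e^{-i\theta}$ from the chain rule is kept apart from $f$, so that replacing $f$ by
its value at $t$ leaves $f(e^{it})\,\partial_zM_\alpha$. -/
lemma dz_poissonIntegral (α : ℝ) {f : Circle → ℂ} (hf : Continuous fun θ : ℝ => f (Circle.exp θ))
    {z : ℂ} (hz : z ∈ disc) : dz (poissonIntegral (α / 2) (α / 2) f) z =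
      rotAvg rotNeg (dz (poissonKernel (α / 2) (α / 2)))
        (fun θ => f (Circle.exp θ) * unitDensity rotNeg θ) z := by
  rw [poissonIntegral_eq_rotAvg, (hasWirt_rotAvg continuous_rotNeg norm_rotNeg
    (contDiffOn_one_poissonKernel α) (hg := by exact continuous_const.mul hf) hz).dz_eq]
  congr 1 with θ
  rw [unitDensity]
  ring

lemma dzbar_poissonIntegral (α : ℝ) {f : Circle → ℂ} (hf : Continuous fun θ : ℝ => f (Circle.exp θ))
    {z : ℂ} (hz : z ∈ disc) : dzbar (poissonIntegral (α / 2) (α / 2) f) z =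
      rotAvg rotNeg (dzbar (poissonKernel (α / 2) (α / 2)))
        (fun θ => f (Circle.exp θ) * unitDensity (fun θ => conj (rotNeg θ)) θ) z := by
  rw [poissonIntegral_eq_rotAvg, (hasWirt_rotAvg continuous_rotNeg norm_rotNeg
    (contDiffOn_one_poissonKernel α) (hg := by exact continuous_const.mul hf) hz).dzbar_eq]
  congr 1 with θ
  rw [unitDensity]
  ring

lemma profile_neg (α β r s : ℝ) : profile α β r (-s) = profile α β r s := by simp [profile]

lemma exists_norm_poissonIntegral_le {α : ℝ} (hα : -1 < α) {f : Circle → ℂ} {B : ℝ}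
    (hB : ∀ θ : ℝ, ‖f (Circle.exp θ)‖ ≤ B) :
    ∃ C : ℝ, ∀ z ∈ disc, ‖poissonIntegral (α / 2) (α / 2) f z‖ ≤ C := by
  obtain ⟨C, hC0, hC⟩ := exists_kernel_bound hα
  refine ⟨B * (C * (2 / (α + 1))), fun z hz => ?_⟩
  obtain ⟨θ, -, hθ⟩ := exists_eq_mul_rotPos z
  have hr : ‖z‖ ∈ Ico (0 : ℝ) 1 := ⟨norm_nonneg z, mem_disc.1 hz⟩
  have hB0 : 0 ≤ B := (norm_nonneg _).trans (hB 0)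
  have hp : Function.Periodic (fun θ : ℝ => (1 / (2 * Real.pi) : ℂ) * f (Circle.exp θ))
      (2 * Real.pi) := fun θ => by simp only [Circle.periodic_exp θ]
  have hb : ∀ θ : ℝ, ‖(1 / (2 * Real.pi) : ℂ) * f (Circle.exp θ)‖ ≤ B := by
    intro θ
    have := norm_unitDensity_le (ε := fun _ => 1) (by simp) θ
    rw [unitDensity, mul_one] at this
    rw [norm_mul]
    calc _ ≤ 1 * B := mul_le_mul this (hB θ) (norm_nonneg _) zero_le_one
      _ = B := one_mul B
  rw [hθ, poissonIntegral_eq_rotAvg]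
  refine (norm_rotAvg_le (k := fun s => C * profile α (α + 1) ‖z‖ s) hp hb
    (continuous_const.mul (continuous_profile _ _ hr)) (fun s hs => ?_) θ).trans ?_
  · have := (hC ‖z‖ hr (-s) (by rwa [abs_neg])).1
    rwa [profile_neg] at this
  · rw [intervalIntegral.integral_const_mul]
    gcongr
    exact integral_profile_le hα hr

/-! ### The derivatives of $M_\alpha$ -/

lemma isTHarmonic_radialM (α : ℝ) : IsTHarmonic α (radialM α) :=
  isTHarmonic_poissonIntegral α continuous_const

lemma periodic_unitDensity {ε : ℝ → ℂ} (hε : Function.Periodic ε (2 * Real.pi)) :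
    Function.Periodic (unitDensity ε) (2 * Real.pi) := fun θ => by
  rw [unitDensity, unitDensity, hε]

lemma continuous_unitDensity {ε : ℝ → ℂ} (hε : Continuous ε) : Continuous (unitDensity ε) :=
  continuous_const.mul hε

lemma continuous_conj_rotNeg : Continuous fun θ => conj (rotNeg θ) :=
  continuous_conj.comp continuous_rotNeg

lemma periodic_conj_rotNeg : Function.Periodic (fun θ => conj (rotNeg θ)) (2 * Real.pi) := fun θ => by
  simp only [periodic_rotNeg θ]

lemma norm_conj_rotNeg (θ : ℝ) : ‖conj (rotNeg θ)‖ = 1 := by rw [RCLike.norm_conj, norm_rotNeg]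

lemma dz_radialM (α : ℝ) {z : ℂ} (hz : z ∈ disc) : dz (radialM α) z =
    rotAvg rotNeg (dz (poissonKernel (α / 2) (α / 2))) (unitDensity rotNeg) z := by
  rw [radialM, dz_poissonIntegral α continuous_const hz]
  simp only [one_mul]

lemma dzbar_radialM (α : ℝ) {z : ℂ} (hz : z ∈ disc) : dzbar (radialM α) z =
    rotAvg rotNeg (dzbar (poissonKernel (α / 2) (α / 2)))
      (unitDensity fun θ => conj (rotNeg θ)) z := by
  rw [radialM, dzbar_poissonIntegral α continuous_const hz]
  simp only [one_mul]

lemma rotAvg_unitDensity_mul_rotPos {Q : ℂ → ℂ} {ε : ℝ → ℂ}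
    (hp : Function.Periodic ε (2 * Real.pi)) (hadd : ∀ s t, ε (s + t) = ε s * ε t) (r t : ℝ) :
    rotAvg rotNeg Q (unitDensity ε) (r * rotPos t) = ε t * rotAvg rotNeg Q (unitDensity ε) r := by
  have h0 := rotAvg_rotNeg_eq (Q := Q) (periodic_unitDensity hp) r 0
  rw [rotPos_zero, mul_one] at h0
  rw [rotAvg_rotNeg_eq (periodic_unitDensity hp), h0, ← intervalIntegral.integral_const_mul]
  congr 1 with s
  rw [zero_add, unitDensity, unitDensity, hadd]
  ring

lemma dz_radialM_mul_rotPos (α : ℝ) {r : ℝ} (hr : r ∈ Ioo (-1 : ℝ) 1) (t : ℝ) :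
    dz (radialM α) (r * rotPos t) = rotNeg t * dz (radialM α) r := by
  rw [dz_radialM α (ofReal_mul_rotPos_mem_disc hr t), dz_radialM α (ofReal_mem_disc hr),
    rotAvg_unitDensity_mul_rotPos periodic_rotNeg rotNeg_add]

lemma dzbar_radialM_mul_rotPos (α : ℝ) {r : ℝ} (hr : r ∈ Ioo (-1 : ℝ) 1) (t : ℝ) :
    dzbar (radialM α) (r * rotPos t) = conj (rotNeg t) * dzbar (radialM α) r := by
  rw [dzbar_radialM α (ofReal_mul_rotPos_mem_disc hr t), dzbar_radialM α (ofReal_mem_disc hr),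
    rotAvg_unitDensity_mul_rotPos periodic_conj_rotNeg fun s t => by rw [rotNeg_add, map_mul]]

/-- The norm of the radial derivative of the zeroth mode of `M_α`. -/
def radialSpeed (α r : ℝ) : ℝ :=
  ‖mode (dz (radialM α)) (0 - 1) r + mode (dzbar (radialM α)) (0 + 1) r‖

/-- The derivatives at $re^{it}$ are those at $r$ times $e^{\mp it}$, so each relevant mode is
$2\pi$ times the value at $r$. By `mode_angular` with $n=0$ the two modes agree, and the norm of
their sum is $4\pi$ times that of either derivative. -/
lemma norm_dz_radialM (α : ℝ) {r : ℝ} (hr : r ∈ Ioo (0 : ℝ) 1) (t : ℝ) :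
    ‖dz (radialM α) (r * rotPos t)‖ = radialSpeed α r / (4 * Real.pi) ∧
    ‖dzbar (radialM α) (r * rotPos t)‖ = radialSpeed α r / (4 * Real.pi) := by
  have hr' : r ∈ Ioo (-1 : ℝ) 1 := ⟨by linarith [hr.1], hr.2⟩
  have e1 : mode (dz (radialM α)) (0 - 1) r = 2 * Real.pi * dz (radialM α) r := by
    have : ∀ θ : ℝ, expMode (0 - 1) θ * dz (radialM α) (r * rotPos θ) = dz (radialM α) r := by
      intro θ
      rw [dz_radialM_mul_rotPos α hr', ← mul_assoc, expMode, rotNeg, ← exp_add]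
      simp
    simp only [mode, rotAvg, this, intervalIntegral.integral_const, sub_zero, real_smul]
    push_cast
    rfl
  have e2 : mode (dzbar (radialM α)) (0 + 1) r = 2 * Real.pi * dzbar (radialM α) r := by
    have : ∀ θ : ℝ, expMode (0 + 1) θ * dzbar (radialM α) (r * rotPos θ) = dzbar (radialM α) r := by
      intro θ
      rw [dzbar_radialM_mul_rotPos α hr', ← mul_assoc, expMode, rotNeg, ← exp_conj, ← exp_add]
      simp
    simp only [mode, rotAvg, this, intervalIntegral.integral_const, sub_zero, real_smul]
    push_cast
    rfl
  have h := mode_angular (isTHarmonic_radialM α).contDiffOn_one 0 hr'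
  rw [Int.cast_zero, zero_mul, mul_eq_zero] at h
  have h := sub_eq_zero.1 (h.resolve_left (ofReal_ne_zero.2 hr.1.ne'))
  have hpi := Real.pi_pos
  have n2 : ‖(2 * Real.pi : ℂ)‖ = 2 * Real.pi := by
    rw [norm_mul, norm_real, Real.norm_of_nonneg hpi.le, norm_ofNat]
  rw [dz_radialM_mul_rotPos α hr', dzbar_radialM_mul_rotPos α hr', norm_mul, norm_mul, norm_rotNeg,
    norm_conj_rotNeg, radialSpeed]
  constructor
  · rw [← h, e1, ← two_mul, norm_mul, norm_mul, norm_ofNat, n2]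
    field_simp
    norm_num
  · rw [h, e2, ← two_mul, norm_mul, norm_mul, norm_ofNat, n2]
    field_simp
    norm_num

lemma exists_norm_mode_radialM_le {α : ℝ} (hα : -1 < α) :
    ∃ B : ℝ, 0 ≤ B ∧ ∀ r ∈ Ioo (0 : ℝ) 1, ‖mode (radialM α) 0 r‖ ≤ B := by
  obtain ⟨C, hC⟩ := exists_norm_poissonIntegral_le hα (f := fun _ => 1) (B := 1) (by simp)
  have hC0 : 0 ≤ C := (norm_nonneg _).trans (hC 0 (by simp [mem_disc]))
  exact ⟨C * (2 * Real.pi), by positivity, fun r hr => norm_mode_le fun θ =>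
    hC _ (ofReal_mul_rotPos_mem_disc ⟨by linarith [hr.1], hr.2⟩ θ)⟩

/-- At $r=0$ the mode is $2\pi c$ with $c>0$ the Poisson constant; continuity moves this to some
$r>0$. -/
lemma mode_radialM_zero_ne_zero {α : ℝ} (hα : -1 < α) :
    ∃ r ∈ Ioo (0 : ℝ) 1, mode (radialM α) 0 r ≠ 0 := by
  have hc := ((continuousOn_mode (isTHarmonic_radialM α).contDiffOn_one.continuousOn 0).continuousAt
    (Ioo_mem_nhds (by norm_num) (by norm_num : (0 : ℝ) < 1)))
  have hpi : (Real.pi : ℂ) ≠ 0 := ofReal_ne_zero.2 Real.pi_ne_zero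
  have h0 : radialM α 0 = poissonConst (α / 2) (α / 2) := by
    rw [radialM, poissonIntegral]
    simp only [zero_mul, mul_one, intervalIntegral.integral_const, poissonKernel]
    simp
    field_simp
  have h1 : mode (radialM α) 0 0 ≠ 0 := by
    rw [mode, rotAvg]
    simp only [ofReal_zero, zero_mul, h0, expMode]
    simp [(poissonConst_pos hα).ne', Real.pi_ne_zero]
  have hev : ∀ᶠ r in 𝓝[>] (0 : ℝ), mode (radialM α) 0 r ≠ 0 :=
    (hc.eventually_ne h1).filter_mono nhdsWithin_le_nhds
  obtain ⟨r, hr, hr'⟩ := (hev.and (Ioo_mem_nhdsGT (zero_lt_one' ℝ))).exists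
  exact ⟨r, hr', hr⟩

lemma exists_lower_bound_radialSpeed {α : ℝ} (hα : -1 < α) (hα0 : α ≠ 0) :
    ∃ κ > 0, ∃ r₁ ∈ Ioo (0 : ℝ) 1, ∀ r ∈ Ico r₁ 1, κ * (1 - r ^ 2) ^ α ≤ radialSpeed α r := by
  obtain ⟨B, -, hB⟩ := exists_norm_mode_radialM_le hα
  obtain ⟨r₀, hr₀, h₀⟩ := mode_radialM_zero_ne_zero hα
  exact (isTHarmonic_radialM α).exists_lower_bound_mode hα0 hB hr₀ h₀

lemma one_le_rpow_min {r : ℝ} (hr : r ∈ Ico (0 : ℝ) 1) (α : ℝ) : 1 ≤ (1 - r) ^ (min α 0) :=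
  Real.one_le_rpow_of_pos_of_le_one_of_nonpos (by linarith [hr.2]) (by linarith [hr.1])
    (min_le_right _ _)

/-- Multiplying the flux bound by $(1-r^2)^\alpha/r$ gives $B\alpha(1-(1-r^2)^\alpha)$. Restricting
to $r\ge\frac12$ controls $1/r$. -/
lemma exists_upper_bound_radialSpeed {α : ℝ} (hα : -1 < α) :
    ∃ C : ℝ, 0 ≤ C ∧ ∀ r ∈ Ico (1 / 2 : ℝ) 1, radialSpeed α r ≤ C * (1 - r) ^ (min α 0) := by
  obtain ⟨B, hB0, hB⟩ := exists_norm_mode_radialM_le hα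
  refine ⟨B * |α|, by positivity, fun r hr => ?_⟩
  have hrI : r ∈ Ioo (0 : ℝ) 1 := ⟨by linarith [hr.1], hr.2⟩
  have hrC : r ∈ Ico (0 : ℝ) 1 := ⟨hrI.1.le, hrI.2⟩
  have hx := one_sub_sq_pos hrI
  have hp := Real.rpow_pos_of_pos hx α
  have h1 := (isTHarmonic_radialM α).norm_flux_zero_le hB hrI
  have h2 : radialSpeed α r = (1 - r ^ 2) ^ α / r * ‖flux α (radialM α) 0 r‖ :=
    (isTHarmonic_radialM α).norm_flux hrI
  have h3 : radialSpeed α r ≤ B * (α * (1 - (1 - r ^ 2) ^ α)) := by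
    rw [h2]
    have hn : 0 ≤ B * (α / 2) * (((1 - r ^ 2) ^ α)⁻¹ - 1) := (norm_nonneg _).trans h1
    calc (1 - r ^ 2) ^ α / r * ‖flux α (radialM α) 0 r‖
        ≤ (1 - r ^ 2) ^ α / (1 / 2) * (B * (α / 2) * (((1 - r ^ 2) ^ α)⁻¹ - 1)) := by
          gcongr
          exact hr.1
      _ = B * (α * (1 - (1 - r ^ 2) ^ α)) := by field_simp
  refine h3.trans ?_
  rw [mul_assoc]
  refine mul_le_mul_of_nonneg_left ?_ hB0
  rcases le_or_gt 0 α with h | h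
  · rw [min_eq_right h, Real.rpow_zero, mul_one, abs_of_nonneg h]
    nlinarith
  · rw [min_eq_left h.le, abs_of_neg h]
    have : (1 - r ^ 2) ^ α ≤ (1 - r) ^ α :=
      Real.rpow_le_rpow_of_nonpos (by linarith [hr.2]) (by nlinarith [hr.1, hr.2]) h.le
    nlinarith

/-- On $|z|\le\frac12$ compactness suffices, since $(1-r)^{\min(\alpha,0)}\ge1$. -/
lemma exists_bound_of_continuousOn_of_bound {v : ℂ → ℂ} (hv : ContinuousOn v disc) {α C : ℝ}
    (hC0 : 0 ≤ C)
    (hC : ∀ r ∈ Ico (1 / 2 : ℝ) 1, ∀ t, ‖v (r * rotPos t)‖ ≤ C * (1 - r) ^ (min α 0)) :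
    ∃ C : ℝ, 0 ≤ C ∧ ∀ r ∈ Ico (0 : ℝ) 1, ∀ t, ‖v (r * rotPos t)‖ ≤ C * (1 - r) ^ (min α 0) := by
  obtain ⟨C', hC'⟩ := (isCompact_closedBall (0 : ℂ) (1 / 2)).exists_bound_of_continuousOn
    (hv.mono (Metric.closedBall_subset_ball (by norm_num)))
  have h0 : 0 ≤ C' := (norm_nonneg _).trans (hC' 0 (by simp))
  refine ⟨C + C', by positivity, fun r hr t => ?_⟩
  have h1 := one_le_rpow_min hr α
  rcases le_or_gt (1 / 2) r with h | h
  · refine (hC r ⟨h, hr.2⟩ t).trans ?_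
    gcongr
    linarith
  · have : (r : ℂ) * rotPos t ∈ Metric.closedBall (0 : ℂ) (1 / 2) := by
      rw [mem_closedBall_zero_iff, norm_mul, norm_rotPos, norm_real, Real.norm_of_nonneg hr.1]
      linarith
    have := hC' _ this
    nlinarith

lemma exists_norm_dz_radialM_le {α : ℝ} (hα : -1 < α) :
    ∃ C : ℝ, 0 ≤ C ∧ ∀ r ∈ Ico (0 : ℝ) 1, ∀ t,
      ‖dz (radialM α) (r * rotPos t)‖ ≤ C * (1 - r) ^ (min α 0) := by
  obtain ⟨C, hC0, hC⟩ := exists_upper_bound_radialSpeed hα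
  refine exists_bound_of_continuousOn_of_bound (isTHarmonic_radialM α).continuousOn_dz
    (C := C / (4 * Real.pi)) (by positivity) fun r hr t => ?_
  rw [(norm_dz_radialM α ⟨by linarith [hr.1], hr.2⟩ t).1, div_mul_eq_mul_div]
  gcongr
  exact hC r hr

lemma exists_norm_dzbar_radialM_le {α : ℝ} (hα : -1 < α) :
    ∃ C : ℝ, 0 ≤ C ∧ ∀ r ∈ Ico (0 : ℝ) 1, ∀ t,
      ‖dzbar (radialM α) (r * rotPos t)‖ ≤ C * (1 - r) ^ (min α 0) := by
  obtain ⟨C, hC0, hC⟩ := exists_upper_bound_radialSpeed hα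
  refine exists_bound_of_continuousOn_of_bound (isTHarmonic_radialM α).continuousOn_dzbar
    (C := C / (4 * Real.pi)) (by positivity) fun r hr t => ?_
  rw [(norm_dz_radialM α ⟨by linarith [hr.1], hr.2⟩ t).2, div_mul_eq_mul_div]
  gcongr
  exact hC r hr

/-! ### Means of the derivatives on circles -/

/-- Combines the two contributions: the increment of $f$ is controlled by the first moment of the
profile, and the constant term by $\sup|f|$ times the bound for $\partial M_\alpha$. Both have order
$(1-r)^{\min(\alpha,0)}$. -/
lemma exists_eLpNorm_rotAvg_le {α : ℝ} (hα0 : α ≠ 0) {f : Circle → ℂ} (hf : AbsContCircle f)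
    {p : ℝ≥0∞} (hp : 1 ≤ p) (hfp : MemLp (circleDeriv f) p arcMeasure) {ε : ℝ → ℂ}
    (hε : Continuous ε) (hεp : Function.Periodic ε (2 * Real.pi)) (hε1 : ∀ θ, ‖ε θ‖ ≤ 1)
    {Q : ℂ → ℂ} (hQ : ContinuousOn Q disc) {C M : ℝ} (hC0 : 0 ≤ C) (hM0 : 0 ≤ M)
    (hC : ∀ r ∈ Ico (0 : ℝ) 1, ∀ s, |s| ≤ Real.pi → ‖Q (r * rotPos s)‖ ≤ C * profile α α r s)
    (hM : ∀ r ∈ Ico (0 : ℝ) 1, ∀ t,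
      ‖rotAvg rotNeg Q ε (r * rotPos t)‖ ≤ M * (1 - r) ^ (min α 0)) :
    ∃ C' : ℝ, 0 ≤ C' ∧ ∀ r ∈ Ico (0 : ℝ) 1,
      eLpNorm (fun t => rotAvg rotNeg Q (fun θ => f (Circle.exp θ) * ε θ) (r * rotPos t)) p
        arcMeasure ≤ ENNReal.ofReal (C' * (1 - r) ^ (min α 0)) := by
  obtain ⟨B, hB0, hB⟩ := hf.exists_bound
  obtain ⟨D, hD0, hD⟩ := exists_integral_profile_mul_abs_le hα0
  set N := (eLpNorm (circleDeriv f) p arcMeasure).toReal with hN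
  have hN' : eLpNorm (circleDeriv f) p arcMeasure = ENNReal.ofReal N :=
    (ENNReal.ofReal_toReal hfp.2.ne).symm
  refine ⟨N * (C * D) + B * M, by positivity, fun r hr => ?_⟩
  have hr' : r ∈ Ioo (-1 : ℝ) 1 := ⟨by linarith [hr.1], hr.2⟩
  have hpw : 0 ≤ (1 - r) ^ (min α 0) := zero_le_one.trans (one_le_rpow_min hr α)
  have h1 := eLpNorm_rotAvg_sub_le hf hp hε hεp hε1 hQ hr (k := fun s => C * profile α α r s)
    (continuous_const.mul (continuous_profile _ _ hr))
    (fun s => mul_nonneg hC0 (profile_nonneg _ _ hr s)) (fun s hs => by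
      rw [← profile_neg]; exact hC r hr (-s) (by rwa [abs_neg]))
  have h2 : eLpNorm (fun t : ℝ => f (Circle.exp t) * rotAvg rotNeg Q ε (r * rotPos t)) p arcMeasure ≤
      ENNReal.ofReal (B * (M * (1 - r) ^ (min α 0))) := by
    have := eLpNorm_le_of_ae_bound (p := p) (μ := arcMeasure)
      (f := fun t : ℝ => f (Circle.exp t) * rotAvg rotNeg Q ε (r * rotPos t))
      (C := B * (M * (1 - r) ^ (min α 0))) (ae_of_all _ fun t => by
        rw [norm_mul]
        exact mul_le_mul (hB t) (hM r hr t) (norm_nonneg _) hB0)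
    simpa using this
  have c1 : Continuous fun t => rotAvg rotNeg Q (fun θ => f (Circle.exp θ) * ε θ) (r * rotPos t) :=
    continuous_slice (continuousOn_rotAvg continuous_rotNeg norm_rotNeg hQ
      (hf.continuous.mul hε)) hr'
  have c2 : Continuous fun t : ℝ => f (Circle.exp t) * rotAvg rotNeg Q ε (r * rotPos t) :=
    hf.continuous.mul (continuous_slice (continuousOn_rotAvg continuous_rotNeg norm_rotNeg hQ hε) hr')
  have h3 := eLpNorm_add_le (μ := arcMeasure) (c1.sub c2).aestronglyMeasurable
    c2.aestronglyMeasurable hp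
  simp only [sub_add_cancel] at h3
  refine h3.trans ((add_le_add h1 h2).trans ?_)
  rw [hN', ← ENNReal.ofReal_mul ENNReal.toReal_nonneg, ← ENNReal.ofReal_add]
  · refine ENNReal.ofReal_le_ofReal ?_
    have : ∫ s in (-Real.pi)..Real.pi, C * profile α α r s * |s| ≤
        C * (D * (1 - r) ^ (min α 0)) := by
      simp only [mul_assoc]
      rw [intervalIntegral.integral_const_mul]
      exact mul_le_mul_of_nonneg_left (hD r hr) hC0
    have := mul_le_mul_of_nonneg_left this (ENNReal.toReal_nonneg : 0 ≤ N)
    linarith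
  · refine mul_nonneg ENNReal.toReal_nonneg (intervalIntegral.integral_nonneg
      (by linarith [Real.pi_pos]) fun s _ => ?_)
    exact mul_nonneg (mul_nonneg hC0 (profile_nonneg _ _ hr s)) (abs_nonneg s)
  · positivity

section PoissonIntegral

variable {α : ℝ} {f : Circle → ℂ} {p : ℝ≥0∞}

lemma exists_eLpNorm_slice_dz_le (hα : -1 < α) (hα0 : α ≠ 0) (hf : AbsContCircle f) (hp : 1 ≤ p)
    (hfp : MemLp (circleDeriv f) p arcMeasure) :
    ∃ C : ℝ, 0 ≤ C ∧ ∀ r ∈ Ico (0 : ℝ) 1,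
      eLpNorm (slice (dz (poissonIntegral (α / 2) (α / 2) f)) r) p arcMeasure ≤
        ENNReal.ofReal (C * (1 - r) ^ (min α 0)) := by
  obtain ⟨C, hC0, hC⟩ := exists_kernel_bound hα
  obtain ⟨M, hM0, hM⟩ := exists_norm_dz_radialM_le hα
  obtain ⟨C', hC'0, hC'⟩ := exists_eLpNorm_rotAvg_le hα0 hf hp hfp
    (continuous_unitDensity continuous_rotNeg) (periodic_unitDensity periodic_rotNeg)
    (norm_unitDensity_le norm_rotNeg) (continuousOn_dz_poissonKernel α) hC0 hM0
    (fun r hr s hs => (hC r hr s hs).2.1) (fun r hr t => by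
      rw [← dz_radialM α (ofReal_mul_rotPos_mem_disc ⟨by linarith [hr.1], hr.2⟩ t)]
      exact hM r hr t)
  refine ⟨C', hC'0, fun r hr => ?_⟩
  convert hC' r hr using 2
  ext t
  rw [slice_eq, dz_poissonIntegral α hf.continuous
    (ofReal_mul_rotPos_mem_disc ⟨by linarith [hr.1], hr.2⟩ t)]

lemma exists_eLpNorm_slice_dzbar_le (hα : -1 < α) (hα0 : α ≠ 0) (hf : AbsContCircle f)
    (hp : 1 ≤ p) (hfp : MemLp (circleDeriv f) p arcMeasure) :
    ∃ C : ℝ, 0 ≤ C ∧ ∀ r ∈ Ico (0 : ℝ) 1,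
      eLpNorm (slice (dzbar (poissonIntegral (α / 2) (α / 2) f)) r) p arcMeasure ≤
        ENNReal.ofReal (C * (1 - r) ^ (min α 0)) := by
  obtain ⟨C, hC0, hC⟩ := exists_kernel_bound hα
  obtain ⟨M, hM0, hM⟩ := exists_norm_dzbar_radialM_le hα
  obtain ⟨C', hC'0, hC'⟩ := exists_eLpNorm_rotAvg_le hα0 hf hp hfp
    (continuous_unitDensity continuous_conj_rotNeg) (periodic_unitDensity periodic_conj_rotNeg)
    (norm_unitDensity_le norm_conj_rotNeg) (continuousOn_dzbar_poissonKernel α) hC0 hM0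
    (fun r hr s hs => (hC r hr s hs).2.2) (fun r hr t => by
      rw [← dzbar_radialM α (ofReal_mul_rotPos_mem_disc ⟨by linarith [hr.1], hr.2⟩ t)]
      exact hM r hr t)
  refine ⟨C', hC'0, fun r hr => ?_⟩
  convert hC' r hr using 2
  ext t
  rw [slice_eq, dzbar_poissonIntegral α hf.continuous
    (ofReal_mul_rotPos_mem_disc ⟨by linarith [hr.1], hr.2⟩ t)]

end PoissonIntegral

/-! ### From circle means to Hardy and Lebesgue spaces -/

/-- Needed for $p=\infty$, where the Hardy norm is a true supremum but the slice norm is an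
essential one. -/
lemma enorm_le_of_eLpNorm_top_le {g : ℝ → ℂ} (hg : Continuous g)
    (hp : Function.Periodic g (2 * Real.pi)) {C : ℝ≥0∞} (h : eLpNorm g ∞ arcMeasure ≤ C) (θ : ℝ) :
    ‖g θ‖ₑ ≤ C := by
  have hae : ∀ᵐ t ∂(volume.restrict (Ioo (0 : ℝ) (2 * Real.pi))), ‖g t‖ₑ ≤ C := by
    have h1 : ∀ᵐ t ∂arcMeasure, ‖g t‖ₑ ≤ C := by
      rw [eLpNorm_exponent_top] at h
      filter_upwards [ae_le_eLpNormEssSup (f := g) (μ := arcMeasure)] with t ht using ht.trans h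
    have hc : ENNReal.ofReal (2 * Real.pi)⁻¹ ≠ 0 := by
      simp only [ne_eq, ENNReal.ofReal_eq_zero, not_le]; positivity
    rw [arcMeasure, Measure.ae_ennreal_smul_measure_iff hc] at h1
    exact ae_mono (Measure.restrict_mono Ioo_subset_Ioc_self le_rfl) h1
  -- Taking the maximum with `C` turns the inequality into an almost everywhere equality of
  -- continuous functions, which holds everywhere on an open interval and extends to its closure.
  have heq : (fun t => max ‖g t‖ₑ C) =ᵐ[volume.restrict (Ioo (0 : ℝ) (2 * Real.pi))] fun _ => C := by
    filter_upwards [hae] with t ht using max_eq_right ht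
  have hcm : Continuous fun t => max ‖g t‖ₑ C := hg.enorm.max continuous_const
  have hon := Measure.eqOn_open_of_ae_eq heq isOpen_Ioo hcm.continuousOn continuousOn_const
  have hcl := hon.closure hcm continuous_const
  rw [closure_Ioo (by positivity)] at hcl
  obtain ⟨y, hy, hxy⟩ := hp.exists_mem_Ico₀ (by positivity) θ
  rw [hxy]
  exact max_eq_right_iff.1 (hcl (Ico_subset_Icc_self hy))

/-- The radius $0$ is included so that for $p=\infty$ the supremum over the disc also covers the
origin. -/
lemma memHardyG_of_eLpNorm_slice_le {v : ℂ → ℂ} (hv : ContinuousOn v disc) {p C : ℝ≥0∞}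
    (hC : C < ∞) (h : ∀ r ∈ Ico (0 : ℝ) 1, eLpNorm (slice v r) p arcMeasure ≤ C) :
    MemHardyG p v := by
  refine ⟨hv.aemeasurable isOpen_disc.measurableSet, fun r hr =>
    (continuous_slice hv ⟨by linarith [hr.1], hr.2⟩).aemeasurable, lt_of_le_of_lt ?_ hC⟩
  rw [hardyNorm]
  split_ifs with hp
  · refine iSup₂_le fun z hz => ?_
    obtain ⟨θ, -, hθ⟩ := exists_eq_mul_rotPos z
    have hr : ‖z‖ ∈ Ico (0 : ℝ) 1 := ⟨norm_nonneg z, mem_disc.1 hz⟩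
    rw [hθ]
    exact enorm_le_of_eLpNorm_top_le (continuous_slice hv ⟨by linarith [hr.1], hr.2⟩)
      (periodic_slice v _) (hp ▸ h _ hr) θ
  · exact iSup₂_le fun r hr => h r ⟨hr.1.le, hr.2⟩

lemma polarCoord_symm_eq (x : ℝ × ℝ) : Complex.polarCoord.symm x = x.1 * rotPos x.2 := by
  rw [Complex.polarCoord_symm_apply, rotPos, exp_mul_I]
  push_cast
  rfl

/-- Polar coordinates use angles in $(-\pi,\pi)$ and `arcMeasure` uses $(0,2\pi]$; periodicity of
the integrand reconciles them. -/
lemma lintegral_disc_eq {G : ℂ → ℝ≥0∞} (hG : Measurable G) :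
    ∫⁻ z in disc, G z = ∫⁻ r in Ioo (0 : ℝ) 1,
      ENNReal.ofReal r * (ENNReal.ofReal (2 * Real.pi) * ∫⁻ θ, G (r * rotPos θ) ∂arcMeasure) := by
  have hpt : polarCoord.target = Ioi (0 : ℝ) ×ˢ Ioo (-Real.pi) Real.pi := rfl
  have hm : Measurable fun x : ℝ × ℝ => disc.indicator G (x.1 * rotPos x.2) := by
    refine (hG.indicator isOpen_disc.measurableSet).comp (Continuous.measurable ?_)
    exact (continuous_ofReal.comp continuous_fst).mul (continuous_rotPos.comp continuous_snd)
  have hm' : Measurable fun x : ℝ × ℝ =>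
      ENNReal.ofReal x.1 • disc.indicator G (x.1 * rotPos x.2) :=
    (ENNReal.measurable_ofReal.comp measurable_fst).mul hm
  rw [← lintegral_indicator isOpen_disc.measurableSet, ← Complex.lintegral_comp_polarCoord_symm, hpt]
  simp only [polarCoord_symm_eq]
  rw [Measure.volume_eq_prod, setLIntegral_prod _ hm'.aemeasurable]
  have hsplit : ∀ r ∈ Ioi (0 : ℝ), ∫⁻ θ in Ioo (-Real.pi) Real.pi,
      ENNReal.ofReal r • disc.indicator G (r * rotPos θ) = (Ioo (0 : ℝ) 1).indicator (fun r =>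
      ENNReal.ofReal r * (ENNReal.ofReal (2 * Real.pi) * ∫⁻ θ, G (r * rotPos θ) ∂arcMeasure)) r := by
    intro r hr
    have hn : ∀ θ, ‖(r : ℂ) * rotPos θ‖ = r := fun θ => by
      rw [norm_mul, norm_rotPos, norm_real, Real.norm_of_nonneg (le_of_lt hr), mul_one]
    by_cases h1 : r < 1
    · have hd : ∀ θ, (r : ℂ) * rotPos θ ∈ disc := fun θ => by rwa [mem_disc, hn]
      rw [indicator_of_mem (show r ∈ Ioo (0 : ℝ) 1 from ⟨hr, h1⟩)]
      simp only [indicator_of_mem (hd _), smul_eq_mul]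
      have hmr : Measurable fun θ => G (r * rotPos θ) :=
        hG.comp (continuous_const.mul continuous_rotPos).measurable
      rw [lintegral_const_mul _ hmr, arcMeasure, lintegral_smul_measure, smul_eq_mul,
        ← mul_assoc (ENNReal.ofReal (2 * Real.pi)), ← ENNReal.ofReal_mul (by positivity),
        mul_inv_cancel₀ (by positivity), ENNReal.ofReal_one, one_mul]
      congr 1
      rw [setLIntegral_congr Ioo_ae_eq_Ioc]
      have := lintegral_Ioc_periodic (G := fun θ => G (r * rotPos θ))
        (fun θ => by simp only [periodic_rotPos θ]) (-Real.pi) 0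
      rwa [show -Real.pi + 2 * Real.pi = Real.pi by ring, zero_add] at this
    · have hd : ∀ θ, (r : ℂ) * rotPos θ ∉ disc := fun θ => by rwa [mem_disc, hn]
      rw [indicator_of_notMem (fun h => h1 h.2)]
      simp only [indicator_of_notMem (hd _), smul_zero, lintegral_zero]
  rw [setLIntegral_congr_fun measurableSet_Ioi hsplit, setLIntegral_indicator measurableSet_Ioo,
    inter_eq_self_of_subset_left (fun r hr => hr.1)]

lemma lintegral_disc_rpow_eq {v : ℂ → ℂ} (hv : ContinuousOn v disc) {p : ℝ≥0∞} (hp0 : p ≠ 0)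
    (hpt : p ≠ ∞) : ∫⁻ z in disc, ‖v z‖ₑ ^ p.toReal = ∫⁻ r in Ioo (0 : ℝ) 1,
      ENNReal.ofReal r * (ENNReal.ofReal (2 * Real.pi) *
        eLpNorm (slice v r) p arcMeasure ^ p.toReal) := by
  have hq := ENNReal.toReal_pos hp0 hpt
  have hm : Measurable (disc.indicator v) := by
    classical
    have := hv.measurable_piecewise (g := 0) continuous_zero.continuousOn isOpen_disc.measurableSet
    rwa [piecewise_eq_indicator] at this
  have h1 : ∫⁻ z in disc, ‖v z‖ₑ ^ p.toReal = ∫⁻ z in disc, ‖disc.indicator v z‖ₑ ^ p.toReal :=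
    setLIntegral_congr_fun isOpen_disc.measurableSet fun z hz => by
      simp only [indicator_of_mem hz]
  rw [h1, lintegral_disc_eq (hm.enorm.pow_const _)]
  refine setLIntegral_congr_fun measurableSet_Ioo fun r hr => ?_
  have hd : ∀ θ, (r : ℂ) * rotPos θ ∈ disc :=
    ofReal_mul_rotPos_mem_disc ⟨by linarith [hr.1], hr.2⟩
  simp only [indicator_of_mem (hd _)]
  rw [eLpNorm_eq_lintegral_rpow_enorm_toReal hp0 hpt, ← ENNReal.rpow_mul,
    one_div_mul_cancel hq.ne', ENNReal.rpow_one]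
  rfl

lemma integrableOn_one_sub_rpow {e : ℝ} (he : -1 < e) :
    IntegrableOn (fun r : ℝ => (1 - r) ^ e) (Ioo 0 1) := by
  have h := (intervalIntegral.intervalIntegrable_rpow' (a := 0) (b := 1) he).comp_sub_left 1
  simp only [sub_zero, sub_self] at h
  exact (intervalIntegrable_iff_integrableOn_Ioo_of_le zero_le_one).1 h.symm

lemma memLpDisc_of_eLpNorm_slice_le {v : ℂ → ℂ} (hv : ContinuousOn v disc) {p : ℝ≥0∞}
    (hp0 : p ≠ 0) (hpt : p ≠ ∞) {C e : ℝ} (hC : 0 ≤ C) (he : -1 < e * p.toReal)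
    (h : ∀ r ∈ Ico (0 : ℝ) 1, eLpNorm (slice v r) p arcMeasure ≤ ENNReal.ofReal (C * (1 - r) ^ e)) :
    MemLpDisc p v := by
  have hq := ENNReal.toReal_pos hp0 hpt
  refine ⟨hv.aestronglyMeasurable isOpen_disc.measurableSet, ?_⟩
  refine (eLpNorm_lt_top_iff_lintegral_rpow_enorm_lt_top hp0 hpt).2 ?_
  rw [lintegral_disc_rpow_eq hv hp0 hpt]
  have hint := ((integrableOn_one_sub_rpow he).const_mul
    (2 * Real.pi * C ^ p.toReal)).lintegral_lt_top
  refine lt_of_le_of_lt (setLIntegral_mono_ae' measurableSet_Ioo (ae_of_all _ fun r hr => ?_)) hint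
  have h1r : 0 < 1 - r := by linarith [hr.2]
  calc ENNReal.ofReal r * (ENNReal.ofReal (2 * Real.pi) * eLpNorm (slice v r) p arcMeasure ^ p.toReal)
      ≤ 1 * (ENNReal.ofReal (2 * Real.pi) * ENNReal.ofReal (C * (1 - r) ^ e) ^ p.toReal) := by
        gcongr
        · rw [← ENNReal.ofReal_one]; exact ENNReal.ofReal_le_ofReal hr.2.le
        · exact h r ⟨hr.1.le, hr.2⟩
    _ = _ := by
        rw [one_mul, ENNReal.ofReal_rpow_of_nonneg (by positivity) hq.le,
          ← ENNReal.ofReal_mul (by positivity), Real.mul_rpow hC (by positivity),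
          ← Real.rpow_mul h1r.le, mul_assoc (2 * Real.pi)]

instance : IsFiniteMeasure (volume.restrict disc) :=
  ⟨by rw [Measure.restrict_apply_univ]; exact measure_ball_lt_top⟩

/-- The disc has finite area, so $L^p\subset L^{p_0}$ for the critical exponent $p_0=-1/\alpha$.
There the lower bound becomes $(1-r^2)^{-1}$, which diverges logarithmically at $r=1$. -/
lemma not_memLpDisc_of_le {v : ℂ → ℂ} (hv : ContinuousOn v disc) {α κ r₁ : ℝ} (hα : α < 0)
    (hκ : 0 < κ) (hr₁ : r₁ ∈ Ioo (0 : ℝ) 1)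
    (h : ∀ r ∈ Ico r₁ 1, ∀ t, κ * (1 - r ^ 2) ^ α ≤ ‖v (r * rotPos t)‖) {p : ℝ≥0∞}
    (hp : ENNReal.ofReal (-1 / α) ≤ p) : ¬ MemLpDisc p v := by
  intro hmem
  have hq : 0 < -1 / α := div_pos_of_neg_of_neg (by norm_num) hα
  set p₀ := ENNReal.ofReal (-1 / α) with hp₀
  have hp0 : p₀ ≠ 0 := by simpa [hp₀] using hq
  have hpt : p₀ ≠ ∞ := ENNReal.ofReal_ne_top
  have hq' : p₀.toReal = -1 / α := ENNReal.toReal_ofReal hq.le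
  have hmem' : MemLp v p₀ (volume.restrict disc) := MemLp.mono_exponent hmem hp
  have hfin := (eLpNorm_lt_top_iff_lintegral_rpow_enorm_lt_top hp0 hpt).1 hmem'.2
  rw [lintegral_disc_rpow_eq hv hp0 hpt, hq'] at hfin
  -- The factor $r_1$ bounds the polar Jacobian from below, and the $\frac12$ comes from
  -- $1-r^2\le2(1-r)$.
  set c := r₁ * (2 * Real.pi * (κ ^ (-1 / α) / 2)) with hc
  have hc0 : 0 < c := by have := hr₁.1; positivity
  have hle : ∫⁻ r in Ioo r₁ 1, ENNReal.ofReal (c * (1 - r)⁻¹) < ∞ := by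
    refine lt_of_le_of_lt ?_ hfin
    refine le_trans ?_ (lintegral_mono_set (Ioo_subset_Ioo_left hr₁.1.le))
    refine setLIntegral_mono_ae' measurableSet_Ioo (ae_of_all _ fun r hr => ?_)
    have hrI : r ∈ Ioo (0 : ℝ) 1 := ⟨hr₁.1.trans hr.1, hr.2⟩
    have hx := one_sub_sq_pos hrI
    have h1r : 0 < 1 - r := by linarith [hr.2]
    have hlow : ENNReal.ofReal (κ * (1 - r ^ 2) ^ α) ≤ eLpNorm (slice v r) p₀ arcMeasure := by
      have hpos : 0 < κ * (1 - r ^ 2) ^ α := by positivity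
      have h1 : eLpNorm (fun _ : ℝ => κ * (1 - r ^ 2) ^ α) p₀ arcMeasure ≤
          eLpNorm (slice v r) p₀ arcMeasure := by
        refine eLpNorm_mono fun t => ?_
        rw [Real.norm_of_nonneg hpos.le]
        exact h r ⟨hr.1.le, hr.2⟩ t
      rw [eLpNorm_const _ hp0 (IsProbabilityMeasure.ne_zero _), measure_univ, ENNReal.one_rpow,
        mul_one, ← ofReal_norm, Real.norm_of_nonneg hpos.le] at h1
      exact h1
    calc ENNReal.ofReal (c * (1 - r)⁻¹)
        ≤ ENNReal.ofReal (r * (2 * Real.pi * (κ * (1 - r ^ 2) ^ α) ^ (-1 / α))) := by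
          refine ENNReal.ofReal_le_ofReal ?_
          rw [Real.mul_rpow hκ.le (by positivity), ← Real.rpow_mul hx.le,
            show α * (-1 / α) = -1 by have := hα.ne; field_simp, Real.rpow_neg_one, hc]
          have hinv : (1 - r)⁻¹ / 2 ≤ (1 - r ^ 2)⁻¹ := by
            rw [div_le_iff₀ two_pos, ← div_eq_inv_mul, inv_eq_one_div,
              div_le_div_iff₀ h1r hx]
            nlinarith [hrI.1, hrI.2]
          calc r₁ * (2 * Real.pi * (κ ^ (-1 / α) / 2)) * (1 - r)⁻¹
              = r₁ * (2 * Real.pi * (κ ^ (-1 / α) * ((1 - r)⁻¹ / 2))) := by ring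
            _ ≤ r * (2 * Real.pi * (κ ^ (-1 / α) * (1 - r ^ 2)⁻¹)) := by
                have := hrI.1
                gcongr
                exact hr.1.le
      _ ≤ _ := by
          rw [ENNReal.ofReal_mul hrI.1.le, ENNReal.ofReal_mul (by positivity),
            ← ENNReal.ofReal_rpow_of_nonneg (by positivity) hq.le]
          gcongr
  have hint : IntegrableOn (fun r : ℝ => c * (1 - r)⁻¹) (Ioo r₁ 1) := by
    refine ⟨(Measurable.aestronglyMeasurable (by fun_prop)), ?_⟩
    rw [hasFiniteIntegral_iff_ofReal]
    · exact hle
    · filter_upwards [ae_restrict_mem measurableSet_Ioo] with r hr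
      have : 0 < 1 - r := by linarith [hr.2]
      positivity
  have hint2 : IntervalIntegrable (fun r : ℝ => (r - 1)⁻¹) volume r₁ 1 := by
    rw [intervalIntegrable_iff_integrableOn_Ioo_of_le hr₁.2.le]
    have h2 : IntegrableOn (fun r : ℝ => -c⁻¹ * (c * (1 - r)⁻¹)) (Ioo r₁ 1) := hint.const_mul _
    refine h2.congr_fun (fun r _ => ?_) measurableSet_Ioo
    change -c⁻¹ * (c * (1 - r)⁻¹) = (r - 1)⁻¹
    rw [← neg_sub 1 r, inv_neg, neg_mul, inv_mul_cancel_left₀ hc0.ne']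
  rw [intervalIntegrable_sub_inv_iff] at hint2
  rcases hint2 with h1 | h1
  · exact hr₁.2.ne h1
  · exact h1 right_mem_uIcc

lemma MemHardyG.congr {p : ℝ≥0∞} {v w : ℂ → ℂ} (hv : MemHardyG p v) (h : EqOn w v disc) :
    MemHardyG p w := by
  have hs : ∀ r ∈ Ioo (0 : ℝ) 1, slice w r = slice v r := fun r hr => funext fun θ =>
    h (ofReal_mul_rotPos_mem_disc ⟨by linarith [hr.1], hr.2⟩ θ)
  refine ⟨hv.1.congr ?_, fun r hr => by rw [hs r hr]; exact hv.2.1 r hr, ?_⟩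
  · exact ae_restrict_of_forall_mem isOpen_disc.measurableSet fun z hz => (h hz).symm
  · have : hardyNorm p w = hardyNorm p v := by
      rw [hardyNorm, hardyNorm]
      congr 1
      · exact iSup_congr fun z => iSup_congr fun hz => by rw [h hz]
      · exact iSup_congr fun r => iSup_congr fun hr => by rw [hs r hr]
    rw [this]
    exact hv.2.2

lemma MemLpDisc.congr {p : ℝ≥0∞} {v w : ℂ → ℂ} (hv : MemLpDisc p v) (h : EqOn w v disc) :
    MemLpDisc p w :=
  MemLp.ae_eq (ae_restrict_of_forall_mem isOpen_disc.measurableSet fun _ hz => (h hz).symm) hv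

end DiscHarmonic

end

/-! ### The corollary -/

open DiscHarmonic in
theorem mainTheorem9 (α : ℝ) (hα : -1 < α) (p : ENNReal) (hp : 1 ≤ p)
    (f : Circle → ℂ) (hf : AbsContCircle f) (hfp : MeasureTheory.MemLp (circleDeriv f) p arcMeasure)
    (u : ℂ → ℂ) (hu : ∀ z ∈ disc, u z = poissonIntegral (α / 2) (α / 2) f z) :
    IsTHarmonic α u ∧
    (0 < α → MemHardyG p (dz u) ∧ MemHardyG p (dzbar u)) ∧
    (α < 0 →
      ((MemHardyG 1 (dz u) ↔ ∀ z ∈ disc, u z = 0) ∧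
        (MemHardyG 1 (dzbar u) ↔ ∀ z ∈ disc, u z = 0)) ∧
      (p < ENNReal.ofReal (-1 / α) → MemLpDisc p (dz u) ∧ MemLpDisc p (dzbar u)) ∧
      (ENNReal.ofReal (-1 / α) ≤ p →
        ¬ MemLpDisc p (dz (radialM α)) ∧ ¬ MemLpDisc p (dzbar (radialM α)))) := by
  have hP := isTHarmonic_poissonIntegral α hf.continuous
  have hT : IsTHarmonic α u := hP.congr hu
  refine ⟨hT, fun h0 => ?_, fun h0 => ⟨⟨⟨fun h => ?_, fun h => ?_⟩, ⟨fun h => ?_, fun h => ?_⟩⟩,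
    fun hlt => ?_, fun hle => ?_⟩⟩
  · obtain ⟨C, -, hC⟩ := exists_eLpNorm_slice_dz_le hα h0.ne' hf hp hfp
    obtain ⟨C', -, hC'⟩ := exists_eLpNorm_slice_dzbar_le hα h0.ne' hf hp hfp
    simp only [min_eq_right h0.le, Real.rpow_zero, mul_one] at hC hC'
    exact ⟨(memHardyG_of_eLpNorm_slice_le hP.continuousOn_dz ENNReal.ofReal_lt_top hC).congr
      (dz_congr hu), (memHardyG_of_eLpNorm_slice_le hP.continuousOn_dzbar ENNReal.ofReal_lt_top
      hC').congr (dzbar_congr hu)⟩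
  · obtain ⟨B, -, hB⟩ := hf.exists_bound
    obtain ⟨C, hC⟩ := exists_norm_poissonIntegral_le hα hB
    exact hT.eq_zero_of_memHardyG_dz h0 (fun z hz => by rw [hu z hz]; exact hC z hz) h
  · refine memHardyG_of_eqOn_zero (fun z hz => ?_) 1
    -- Vanishing on the open disc is enough: there $u$ agrees with the zero function, so its
    -- derivatives vanish as well.
    rw [dz_congr (v := fun _ => 0) h hz, (HasWirt.const 0 z).dz_eq]
  · obtain ⟨B, -, hB⟩ := hf.exists_bound
    obtain ⟨C, hC⟩ := exists_norm_poissonIntegral_le hα hB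
    exact hT.eq_zero_of_memHardyG_dzbar h0 (fun z hz => by rw [hu z hz]; exact hC z hz) h
  · refine memHardyG_of_eqOn_zero (fun z hz => ?_) 1
    rw [dzbar_congr (v := fun _ => 0) h hz, (HasWirt.const 0 z).dzbar_eq]
  · obtain ⟨C, hC0, hC⟩ := exists_eLpNorm_slice_dz_le hα h0.ne hf hp hfp
    obtain ⟨C', hC0', hC'⟩ := exists_eLpNorm_slice_dzbar_le hα h0.ne hf hp hfp
    rw [min_eq_left h0.le] at hC hC'
    have hp0 : p ≠ 0 := (zero_lt_one.trans_le hp).ne'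
    have hpt : p ≠ ⊤ := hlt.ne_top
    -- Integrability of $(1-r)^{\alpha p}$ at $r=1$; multiplying $p<-1/\alpha$ by $\alpha<0$
    -- reverses the inequality.
    have he : -1 < α * p.toReal := by
      have h1 := (ENNReal.lt_ofReal_iff_toReal_lt hpt).1 hlt
      rwa [lt_div_iff_of_neg h0, mul_comm] at h1
    exact ⟨(memLpDisc_of_eLpNorm_slice_le hP.continuousOn_dz hp0 hpt hC0 he hC).congr
      (dz_congr hu), (memLpDisc_of_eLpNorm_slice_le hP.continuousOn_dzbar hp0 hpt hC0' he
      hC').congr (dzbar_congr hu)⟩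
  · obtain ⟨κ, hκ, r₁, hr₁, H⟩ := exists_lower_bound_radialSpeed hα h0.ne
    have hpi := Real.pi_pos
    have hκ' : 0 < κ / (4 * Real.pi) := by positivity
    have key : ∀ r ∈ Set.Ico r₁ 1, κ / (4 * Real.pi) * (1 - r ^ 2) ^ α ≤
        radialSpeed α r / (4 * Real.pi) := fun r hr => by
      rw [div_mul_eq_mul_div]
      exact div_le_div_of_nonneg_right (H r hr) (by positivity)
    have hM := isTHarmonic_radialM α
    exact ⟨not_memLpDisc_of_le hM.continuousOn_dz h0 hκ' hr₁ (fun r hr t => by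
        rw [(norm_dz_radialM α ⟨hr₁.1.trans_le hr.1, hr.2⟩ t).1]; exact key r hr) hle,
      not_memLpDisc_of_le hM.continuousOn_dzbar h0 hκ' hr₁ (fun r hr t => by
        rw [(norm_dz_radialM α ⟨hr₁.1.trans_le hr.1, hr.2⟩ t).2]; exact key r hr) hle⟩
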